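/- Let $\mathcal X$ be a unital $C^*$-algebra and $\mathcal M$ a $\sigma$-finite von Neumann algebra on a Hilbert space $\mathcal H$. Let $\mathcal M_*$ be the space of normal linear functionals on $\mathcal M$, i.e. those of the form $A\mapsto \mathrm{Tr}[\sigma A]$ with $\sigma$ a trace class operator on $\mathcal H$. Let $\mathrm{CP}(\mathcal X,\mathcal M)$ be the set of completely positive linear maps $\mathcal X\to\mathcal M$; write $T_1\le T_2$ if $T_2-T_1\in \mathrm{CP}(\mathcal X,\mathcal M)$, and $T_1\perp T_2$ if $0$ is the only $T'\in\mathrm{CP}(\mathcal X,\mathcal M)$ with $T'\le T_1$ and $T'\le T_2$. Let $T\in \mathrm{CP}(\mathcal X,\mathcal M)$ and let $(\pi_T,\mathcal K_T,V_T)$ be a minimal Stinespring representation of $T$: $\pi_T$ is a representation of $\mathcal X$ on the Hilbert space $\mathcal K_T$, $V_T\in B(\mathcal H,\mathcal K_T)$, $T(X)=V_T^*\pi_T(X)V_T$ for all $X\in\mathcal X$, and $\pi_T(\mathcal X)V_T\mathcal H$ spans a dense subspace of $\mathcal K_T$. Let $\pi_T(\mathcal X)^c\subseteq B(\mathcal K_T)$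 be the $\sigma$-weak closure of the linear span of all $R\in\pi_T(\mathcal X)'$ such that $0\le R\le 1$ and the map $X\mapsto V_T^*R\pi_T(X)V_T$ belongs to $\mathrm{CP}(\mathcal X,\mathcal M)$. Let $(S,\mathcal F,\mu)$ be a CP-measure space of $T$: $(S,\mathcal F)$ is a measurable space and $\mu:\mathcal F\to \mathrm{CP}(\mathcal X,\mathcal M)$ satisfies $\mu(S)=T$ and $\rho(\mu(\bigcup_i\Delta_i)X)=\sum_i\rho(\mu(\Delta_i)X)$ for all $\rho\in\mathcal M_*$, all $X\in\mathcal X$ and all sequences $(\Delta_i)$ of mutually disjoint sets in $\mathcal F$. It is called orthogonal if $\mu(\Delta)\perp\mu(\Delta^c)$ for every $\Delta\in\mathcal F$. Let $\nu$ be a finite positive measure on $(S,\mathcal F)$ that is equivalent to the measure $\Delta\mapsto\rho_0(\mu(\Delta)1)$ for some normal faithful state $\rho_0$ on $\mathcal M$. Then there is a unique linear map $\kappa_\mu:L^\infty(\nu)\to\pi_T(\mathcal X)^c$ such that, for all $f\in L^\infty(\nu)$ and $X\in\mathcal X$, one has $V_T^*\kappa_\mu(f)\pi_T(X)V_T\in\mathcal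 M$ and $$\rho\bigl(V_T^*\kappa_\mu(f)\pi_T(X)V_T\bigr)=\int f(s)\,d\rho(\mu(s)X)\qquad\text{for every }\rho\in\mathcal M_*,$$ where the integral is taken with respect to the complex measure $\Delta\mapsto\rho(\mu(\Delta)X)$. Moreover, the following conditions are equivalent: (1) $(S,\mathcal F,\mu)$ is an orthogonal CP-measure space of $T$; (2) $\kappa_\mu$ is a $*$-isomorphism of $L^\infty(\nu)$ into $\pi_T(\mathcal X)^c$, that is, an injective $*$-homomorphism; (3) $\kappa_\mu$ is a $*$-representation, that is, a $*$-homomorphism. If these conditions hold, then the range $\{\kappa_\mu(f) : f\in L^\infty(\nu)\}$ is an abelian von Neumann subalgebra of $\pi_T(\mathcal X)^c$ (containing the identity operator of $\mathcal K_T$). -/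

import Mathlib

open MeasureTheory Function
open scoped ENNReal CStarAlgebra ComplexOrder

noncomputable section

/-! ### Normal functionals and the `σ`-weak topology -/

section SigmaWeak

variable {H : Type*} [NormedAddCommGroup H] [InnerProductSpace ℂ H] [CompleteSpace H]

/-- The functional `A ↦ Tr[σ A]` of the trace class operator `σ = ∑ₙ |ηₙ⟩⟨ξₙ|`, where `ξ` and `η`
are square-summable sequences in `H`. The trace class operators on `H` are exactly the operators
of this form. -/
def traceClassFunctional (ξ η : lp (fun _ : ℕ => H) 2) (A : H →L[ℂ] H) : ℂ :=
  ∑' n, inner ℂ (ξ n) (A (η n))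

variable (H) in
/-- The `σ`-weak topology on `B(H)`: the coarsest topology for which the functionals
`A ↦ Tr[σ A]`, with `σ` of trace class, are continuous. -/
@[reducible] def sigmaWeakTopology : TopologicalSpace (H →L[ℂ] H) :=
  TopologicalSpace.induced
    (fun (A : H →L[ℂ] H) (p : lp (fun _ : ℕ => H) 2 × lp (fun _ : ℕ => H) 2) =>
      traceClassFunctional p.1 p.2 A) inferInstance

/-- A linear functional `ρ` on `M` is normal if `ρ(A) = Tr[σ A]` on `M` for some trace class
operator `σ` on `H`. -/
def VonNeumannAlgebra.IsNormal (M : VonNeumannAlgebra H)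
    (ρ : M.toStarSubalgebra →ₗ[ℂ] ℂ) : Prop :=
  ∃ ξ η : lp (fun _ : ℕ => H) 2, ∀ a : M.toStarSubalgebra,
    ρ a = traceClassFunctional ξ η (a : H →L[ℂ] H)

/-- Normal faithful states on `M`. -/
structure VonNeumannAlgebra.IsNormalFaithfulState (M : VonNeumannAlgebra H)
    (ρ : M.toStarSubalgebra →ₗ[ℂ] ℂ) : Prop where
  normal : M.IsNormal ρ
  map_nonneg : ∀ a : M.toStarSubalgebra, 0 ≤ (a : H →L[ℂ] H) → 0 ≤ ρ a
  map_one : ρ 1 = 1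
  faithful : ∀ a : M.toStarSubalgebra, 0 ≤ (a : H →L[ℂ] H) → ρ a = 0 → a = 0

/-- `M` is `σ`-finite: every family of nonzero, mutually orthogonal projections of `M` is
countable. -/
def VonNeumannAlgebra.IsSigmaFinite (M : VonNeumannAlgebra H) : Prop :=
  ∀ P : Set (H →L[ℂ] H), (∀ p ∈ P, p ∈ M ∧ IsStarProjection p ∧ p ≠ 0) →
    P.Pairwise (fun p q => p * q = 0) → P.Countable

end SigmaWeak

variable {X : Type*} [CStarAlgebra X] [PartialOrder X] [StarOrderedRing X]
  {H : Type*} [NormedAddCommGroup H] [InnerProductSpace ℂ H] [CompleteSpace H]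
  {K : Type*} [NormedAddCommGroup K] [InnerProductSpace ℂ K] [CompleteSpace K]
  {M : VonNeumannAlgebra H} {S : Type*} [MeasurableSpace S]

/-! ### Completely positive maps with values in a von Neumann algebra -/

variable (X M) in
/-- `CP(X, M)`: the completely positive maps from `X` to `B(H)` with range in `M`. -/
structure CPMap extends X →CP (H →L[ℂ] H) where
  map_mem' : ∀ x, toFun x ∈ M.toStarSubalgebra

instance : CoeFun (CPMap X M) (fun _ => X → M.toStarSubalgebra) :=
  ⟨fun T x => ⟨T.toFun x, T.map_mem' x⟩⟩

/-- `T₁ ≤ T₂` if `T₂ - T₁` is an element of `CP(X, M)`. -/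
instance : LE (CPMap X M) :=
  ⟨fun T₁ T₂ => ∃ R : CPMap X M, ∀ x, T₂ x - T₁ x = R x⟩

/-- `T₁ ⊥ T₂`: the only `T' ∈ CP(X, M)` with `T' ≤ T₁` and `T' ≤ T₂` is `0`. -/
def CPMap.Orthogonal (T₁ T₂ : CPMap X M) : Prop :=
  ∀ T' : CPMap X M, T' ≤ T₁ → T' ≤ T₂ → ∀ x, T' x = 0

/-! ### Minimal Stinespring representations and the relative commutant -/

variable (K) in
/-- A minimal Stinespring representation `(π, K, V)` of `T`. -/
structure MinimalStinespring (T : CPMap X M) where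
  π : X →⋆ₐ[ℂ] (K →L[ℂ] K)
  V : H →L[ℂ] K
  eq_compress : ∀ x, (T x : H →L[ℂ] H) = V.adjoint ∘L π x ∘L V
  dense : (Submodule.span ℂ {k : K | ∃ x ξ, k = π x (V ξ)}).topologicalClosure = ⊤

/-- The `M`-relative commutant `π_T(X)ᶜ` of `π_T(X)`: the `σ`-weak closure of the linear span of
the `R ∈ π_T(X)'` with `0 ≤ R ≤ 1` for which `x ↦ V* R π(x) V` is an element of `CP(X, M)`. -/
def MinimalStinespring.relCommutant {T : CPMap X M} (D : MinimalStinespring K T) :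
    Set (K →L[ℂ] K) :=
  @closure _ (sigmaWeakTopology K)
    (Submodule.span ℂ {R : K →L[ℂ] K | R ∈ Set.centralizer (Set.range D.π) ∧ 0 ≤ R ∧ R ≤ 1 ∧
      ∃ T' : CPMap X M, ∀ x, (T' x : H →L[ℂ] H) = D.V.adjoint ∘L R ∘L D.π x ∘L D.V} :
      Set (K →L[ℂ] K))

/-! ### CP-measure spaces -/

variable (S X M) in
/-- A `CP(X, M)`-valued measure on the measurable space `S`. Only the values on measurable sets
are meaningful. -/
structure CPMeasure where
  toFun : Set S → CPMap X M
  hasSum_iUnion : ∀ Δ : ℕ → Set S, (∀ i, MeasurableSet (Δ i)) → Pairwise (Disjoint on Δ) →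
    ∀ ρ : M.toStarSubalgebra →ₗ[ℂ] ℂ, M.IsNormal ρ → ∀ x : X,
      HasSum (fun i => ρ (toFun (Δ i) x)) (ρ (toFun (⋃ i, Δ i) x))

instance : CoeFun (CPMeasure X M S) (fun _ => Set S → CPMap X M) := ⟨CPMeasure.toFun⟩

/-- `(S, μ)` is an orthogonal CP-measure space with barycenter `T`. -/
def CPMeasure.IsOrthogonalOf (μ : CPMeasure X M S) (T : CPMap X M) : Prop :=
  μ Set.univ = T ∧ ∀ Δ : Set S, MeasurableSet Δ → (μ Δ).Orthogonal (μ Δᶜ)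

open Classical in
/-- The complex measure `Δ ↦ ρ(μ(Δ, x))`, for a normal functional `ρ` on `M` and `x ∈ X`. -/
def CPMeasure.scalarMeasure (μ : CPMeasure X M S) {ρ : M.toStarSubalgebra →ₗ[ℂ] ℂ}
    (hρ : M.IsNormal ρ) (x : X) : ComplexMeasure S where
  measureOf' Δ := if MeasurableSet Δ then ρ (μ Δ x) else 0
  empty' := by
    have h := μ.hasSum_iUnion (fun _ => ∅) (fun _ => MeasurableSet.empty)
      (fun _ _ _ => by simp [onFun]) ρ hρ x
    simpa [summable_const_iff] using h.summable
  not_measurable' Δ hΔ := if_neg hΔ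
  m_iUnion' Δ hΔ hd := by
    simpa [hΔ, MeasurableSet.iUnion hΔ] using μ.hasSum_iUnion Δ hΔ hd ρ hρ x

/-- `ν` and `ρ ∘ μ : Δ ↦ ρ(μ(Δ, 1))` are equivalent measures (they have the same null sets). -/
def CPMeasure.IsEquivalentTo (μ : CPMeasure X M S) (ρ : M.toStarSubalgebra →ₗ[ℂ] ℂ)
    (ν : Measure S) : Prop :=
  ∀ Δ : Set S, MeasurableSet Δ → (ν Δ = 0 ↔ ρ (μ Δ 1) = 0)

/-- The defining property of the map `κ_μ : L^∞(ν) → π_T(X)ᶜ`: for all `f` and `x`, the operator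
`V* κ(f) π(x) V` is the element `∫ f(s) dμ(s, x)` of `M`, that is,
`ρ(V* κ(f) π(x) V) = ∫ f(s) dρ(μ(s, x))` for every normal functional `ρ` on `M`. -/
structure CPMeasure.IsKappa (μ : CPMeasure X M S) {T : CPMap X M} (D : MinimalStinespring K T)
    (ν : Measure S) (κ : Lp ℂ ∞ ν →ₗ[ℂ] (K →L[ℂ] K)) : Prop where
  mem_relCommutant : ∀ f, κ f ∈ D.relCommutant
  integral_eq : ∀ (f : Lp ℂ ∞ ν) (x : X), ∃ a : M.toStarSubalgebra,
    (a : H →L[ℂ] H) = D.V.adjoint ∘L κ f ∘L D.π x ∘L D.V ∧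
    ∀ (ρ : M.toStarSubalgebra →ₗ[ℂ] ℂ) (hρ : M.IsNormal ρ),
      ρ a = ∫ᵛ s, f s ∂[ContinuousLinearMap.mul ℝ ℂ; μ.scalarMeasure hρ x]

/-- A linear map `κ : L^∞(ν) → B(K)` is a `*`-representation if it is multiplicative and preserves
the involution. Here `f • g` is the pointwise product and `star f` the complex conjugate. -/
structure IsStarRepresentation {ν : Measure S} (κ : Lp ℂ ∞ ν →ₗ[ℂ] (K →L[ℂ] K)) : Prop where
  map_mul : ∀ f g : Lp ℂ ∞ ν, κ (f • g : Lp ℂ ∞ ν) = κ f * κ g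
  map_star : ∀ f : Lp ℂ ∞ ν, κ (star f) = star (κ f)

end

set_option linter.unusedSectionVars false

section

/-! ### Positivity of operator matrices -/

/-! Since `μ Δ ≤ T`, a Radon-Nikodym theorem (`exists_radonNikodym`) gives an operator `P Δ` in the
commutant of `π` with `0 ≤ P Δ ≤ 1` and `V* P(Δ) π(x) V = μ(Δ) x`. The vectors `π(x) V ξ` span a
dense subspace, so an operator of the commutant is determined by its compression `x ↦ V* R π(x) V`
(`eq_of_compress_eq`). Hence `P` is finitely additive with `P(S) = 1`, and faithfulness of `ρ₀`
makes `P Δ = 0` equivalent to `ν Δ = 0`. The map `κ` is `f ↦ ∫ f dP`, bounded by the Cauchy-Schwarz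
inequality; it is unique for the same reason.

Multiplicativity of `κ` means that every `R = P Δ` is a projection, and so does orthogonality. If `μ
Δ ⊥ μ Δᶜ`, the compression of `R (1 - R)` lies below both maps, hence vanishes. The delicate point
is that it takes values in `M`: `compress_mem_iff` recasts this condition as commutation with lifts
to `K` of the unitaries of `M'`, which is stable under products. Conversely, a common minorant has a
derivative below `R` and below `1 - R`, which is `0` when `R` is a projection.

For the range, the bicommutant of the values of `P` has to consist of integrals. Writing `ρ₀` as a
trace class functional gives countably many vectors that jointly separate `P`, and a
disjointification merges them into one vector `k`. For `B` in the bicommutant, the classical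
Radon-Nikodym theorem gives at each vector `w` some `f` with `B w = κ f w`; the separating vector
then makes one `f` serve for all `w` (`exists_eq_integral`). -/

theorem CStarAlgebra.exists_eq_star_mul_self {A : Type*} [CStarAlgebra A] [PartialOrder A]
    [StarOrderedRing A] {a : A} (ha : 0 ≤ a) : ∃ b : A, a = star b * b :=
  CStarAlgebra.nonneg_iff_eq_star_mul_self.mp ha

/-- Take `c = a⁻`: then `c a c = -c³` and `c³ = b* b`. If `b = 0`, then `c³ = 0`, so `c = 0` and `a
= a⁺`. The pair is a certificate against which positivity can be tested. -/
theorem IsSelfAdjoint.exists_star_mul_mul_eq_neg {A : Type*} [CStarAlgebra A] [PartialOrder A]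
    [StarOrderedRing A] {a : A} (ha : IsSelfAdjoint a) :
    ∃ b c : A, star c * a * c = -(star b * b) ∧ (b = 0 → 0 ≤ a) := by
  set C := a⁻ with hC
  have hC0 : 0 ≤ C := CFC.negPart_nonneg a
  have hCs : star C = C := hC0.isSelfAdjoint
  have hAC : star C * a * C = -(C * C * C) := by
    have h1 : a = a⁺ - a⁻ := (CFC.posPart_sub_negPart a).symm
    have h2 : a⁻ * a⁺ = 0 := CFC.negPart_mul_posPart a
    rw [hCs]
    conv_lhs => rw [h1]
    rw [mul_sub, h2, zero_sub, neg_mul]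
  have h3 : 0 ≤ C * C * C := by
    simpa [hCs] using star_left_conjugate_nonneg hC0 C
  obtain ⟨B, hB⟩ := CStarAlgebra.nonneg_iff_eq_star_mul_self.mp h3
  refine ⟨B, C, by rw [hAC, hB], fun hB0 => ?_⟩
  have hC3 : C * C * C = 0 := by rw [hB, hB0]; simp
  have hC2 : C * C = 0 := by
    have : star (C * C) * (C * C) = 0 := by
      rw [star_mul, hCs, ← mul_assoc, hC3, zero_mul]
    exact (CStarRing.star_mul_self_eq_zero_iff _).mp this
  have hC1 : C = 0 := by
    have : star C * C = 0 := by rw [hCs, hC2]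
    exact (CStarRing.star_mul_self_eq_zero_iff _).mp this
  have : a = a⁺ := by
    conv_lhs => rw [← CFC.posPart_sub_negPart a]
    rw [← hC, hC1, sub_zero]
  rw [this]
  exact CFC.posPart_nonneg a

section OperatorMatrix

variable {H : Type*} [NormedAddCommGroup H] [InnerProductSpace ℂ H] [CompleteSpace H]
  {n : Type*} [Fintype n]

namespace CStarMatrix

theorem sum_inner_star_mul_mul (A B : CStarMatrix n n (H →L[ℂ] H)) (ξ : n → H) :
    ∑ i, ∑ j, inner ℂ (ξ i) ((star B * A * B) i j (ξ j)) =
      ∑ k, ∑ l, inner ℂ (∑ i, B k i (ξ i)) (A k l (∑ j, B l j (ξ j))) := by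
  have h : ∀ i j, inner ℂ (ξ i) ((star B * A * B) i j (ξ j)) =
      ∑ k, ∑ l, inner ℂ (B k i (ξ i)) (A k l (B l j (ξ j))) := by
    intro i j
    rw [mul_assoc, mul_apply, sum_apply, inner_sum]
    refine Finset.sum_congr rfl fun k _ => ?_
    rw [star_apply, mul_apply_eq_comp, ContinuousLinearMap.star_eq_adjoint,
      ContinuousLinearMap.adjoint_inner_right, mul_apply, sum_apply, inner_sum]
    rfl
  simp_rw [h, map_sum, sum_inner, inner_sum]
  rw [Finset.sum_congr rfl fun i _ => Finset.sum_comm, Finset.sum_comm]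
  refine Finset.sum_congr rfl fun k _ => ?_
  rw [Finset.sum_congr rfl fun i _ => Finset.sum_comm, Finset.sum_comm]

theorem sum_inner_star_mul_self (B : CStarMatrix n n (H →L[ℂ] H)) (ξ : n → H) :
    ∑ i, ∑ j, inner ℂ (ξ i) ((star B * B) i j (ξ j)) =
      ((∑ l, ‖∑ j, B l j (ξ j)‖ ^ 2 : ℝ) : ℂ) := by
  classical
  have := sum_inner_star_mul_mul 1 B ξ
  rw [mul_one] at this
  rw [this]
  push_cast
  refine Finset.sum_congr rfl fun l _ => ?_
  rw [Finset.sum_eq_single l (fun k _ hk => by rw [one_apply_ne hk.symm]; simp) (by simp),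
    one_apply_eq]
  exact inner_self_eq_norm_sq_to_K (𝕜 := ℂ) _

theorem sum_inner_nonneg {A : CStarMatrix n n (H →L[ℂ] H)} (hA : 0 ≤ A) (ξ : n → H) :
    0 ≤ ∑ i, ∑ j, inner ℂ (ξ i) (A i j (ξ j)) := by
  classical
  obtain ⟨B, rfl⟩ := CStarAlgebra.exists_eq_star_mul_self hA
  rw [sum_inner_star_mul_self]
  exact_mod_cast Finset.sum_nonneg fun l _ => by positivity

/-- With `C* A C = -B* B`, evaluating the form of `A` at `C ξ` gives `-‖B ξ‖²`, which must be
nonnegative. So `B = 0`, and `A` is positive in the abstract order of the matrix algebra. -/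
theorem nonneg_of_sum_inner_nonneg {A : CStarMatrix n n (H →L[ℂ] H)} (hA : IsSelfAdjoint A)
    (h : ∀ ξ : n → H, 0 ≤ ∑ i, ∑ j, inner ℂ (ξ i) (A i j (ξ j))) : 0 ≤ A := by
  classical
  obtain ⟨B, C, hBC, hB⟩ := IsSelfAdjoint.exists_star_mul_mul_eq_neg hA
  refine hB ?_
  have key : ∀ ξ : n → H, ∀ l, ∑ j, B l j (ξ j) = 0 := by
    intro ξ
    have e1 := h (fun i => ∑ j, C i j (ξ j))
    have e2 := sum_inner_star_mul_mul A C ξ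
    have e3 := sum_inner_star_mul_self B ξ
    have e4 : ∑ i, ∑ j, inner ℂ (ξ i) ((star C * A * C) i j (ξ j)) =
        - ∑ i, ∑ j, inner ℂ (ξ i) ((star B * B) i j (ξ j)) := by
      simp_rw [← Finset.sum_neg_distrib, hBC]
      simp only [neg_apply]
      simp only [FunLike.coe_neg, Pi.neg_apply, inner_neg_right]
    rw [← e2, e4, e3] at e1
    have e5 : ∑ l, ‖∑ j, B l j (ξ j)‖ ^ 2 ≤ 0 := by
      have : (0 : ℝ) ≤ -∑ l, ‖∑ j, B l j (ξ j)‖ ^ 2 := by exact_mod_cast e1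
      linarith
    have e6 := (Finset.sum_eq_zero_iff_of_nonneg (fun l _ => by positivity)).mp
      (le_antisymm e5 (Finset.sum_nonneg fun l _ => by positivity))
    intro l
    simpa using e6 l (Finset.mem_univ l)
  refine CStarMatrix.ext fun l i => ContinuousLinearMap.ext fun v => ?_
  have := key (Pi.single i v) l
  rw [Finset.sum_eq_single i (fun j _ hj => by simp [Pi.single_eq_of_ne hj]) (by simp)] at this
  simpa using this

end CStarMatrix
end OperatorMatrix

end

section

/-! ### Completely positive maps and their kernels -/

section CompletelyPositive

variable {X : Type*} [CStarAlgebra X] [PartialOrder X] [StarOrderedRing X]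
  {H : Type*} [NormedAddCommGroup H] [InnerProductSpace ℂ H] [CompleteSpace H]
  {K : Type*} [NormedAddCommGroup K] [InnerProductSpace ℂ K] [CompleteSpace K]

theorem CStarAlgebra.star_mul_self_nonneg' {A : Type*} [CStarAlgebra A] [PartialOrder A]
    [StarOrderedRing A] (a : A) : 0 ≤ star a * a :=
  star_mul_self_nonneg a

theorem CStarMatrix.nonneg_of_star_mul {n : Type*} [Fintype n] (x : n → X) :
    0 ≤ (CStarMatrix.ofMatrix fun i j => star (x i) * x j : CStarMatrix n n X) := by
  classical
  rcases isEmpty_or_nonempty n with h | ⟨⟨i₀⟩⟩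
  · exact (CStarMatrix.ext fun i => h.elim i).le
  -- The matrix equals `Y* Y`, where `Y` has `x` as its row `i₀` and zeros elsewhere.
  · have := CStarAlgebra.star_mul_self_nonneg'
      (CStarMatrix.ofMatrix fun k j => if k = i₀ then x j else 0 : CStarMatrix n n X)
    convert this using 1
    ext i j
    rw [CStarMatrix.mul_apply, Finset.sum_eq_single i₀]
    · rw [CStarMatrix.star_apply]
      change _ = star (if i₀ = i₀ then x i else 0) * (if i₀ = i₀ then x j else 0)
      rw [if_pos rfl, if_pos rfl]
      rfl
    · intro k _ hk
      rw [CStarMatrix.star_apply]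
      change star (if k = i₀ then x i else 0) * (if k = i₀ then x j else 0) = 0
      rw [if_neg hk, star_zero, zero_mul]
    · simp

theorem CompletelyPositiveMap.sum_inner_nonneg (Φ : X →CP (H →L[ℂ] H)) {n : Type*} [Fintype n]
    (x : n → X) (ξ : n → H) :
    0 ≤ ∑ i, ∑ j, inner ℂ (ξ i) (Φ (star (x i) * x j) (ξ j)) :=
  CStarMatrix.sum_inner_nonneg (Φ.map_cstarMatrix_nonneg _ (CStarMatrix.nonneg_of_star_mul x)) ξ

theorem CompletelyPositiveMap.finsupp_sum_inner_nonneg (Φ : X →CP (H →L[ℂ] H)) (c : X →₀ H) :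
    0 ≤ c.sum fun x ξ => c.sum fun y η => inner ℂ ξ (Φ (star x * y) η) := by
  have := Φ.sum_inner_nonneg (fun i : c.support => (i : X)) (fun i => c i)
  simp only [Finsupp.sum]
  rw [← Finset.sum_coe_sort c.support]
  simp_rw [← Finset.sum_coe_sort c.support (fun y => inner ℂ (c _) (Φ (star _ * y) (c y)))]
  exact this

theorem CompletelyPositiveMap.map_star' (Φ : X →CP (H →L[ℂ] H)) (x : X) :
    Φ (star x) = star (Φ x) := map_star Φ x

/-- The Kolmogorov decomposition of a completely positive map. -/
theorem CompletelyPositiveMap.exists_kolmogorov (Φ : X →CP (H →L[ℂ] H)) :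
    ∃ (k : Matrix X X (H →L[ℂ] H)) (_ : Fact k.PosSemidef)
      (W : X → H →L[ℂ] RKHS.OfKernel k),
      ∀ x y ξ η, inner ℂ (W x ξ) (W y η) = inner ℂ ξ (Φ (star x * y) η) := by
  let k : Matrix X X (H →L[ℂ] H) := Matrix.of fun x y => Φ (star x * y)
  have hk : k.PosSemidef := by
    have htfae := (RKHS.posSemidef_tfae (K := k)).out 0 2
    refine htfae.mpr ⟨?_, fun c => ?_⟩
    · ext1 x y
      simp [k, Matrix.conjTranspose_apply, ← Φ.map_star']
    · have := Φ.finsupp_sum_inner_nonneg c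
      -- The kernel criterion places the operator in the first slot, so its sum is the conjugate of
      -- the form of `Φ`. Only the real part matters.
      have h2 : (c.sum fun x w ↦ c.sum fun x' w' ↦ inner ℂ (k x' x w) w') =
          star (c.sum fun x ξ => c.sum fun y η => inner ℂ ξ (Φ (star x * y) η)) := by
        rw [Finsupp.sum_comm]
        simp only [Finsupp.sum, star_sum, k, Matrix.of_apply]
        refine Finset.sum_congr rfl fun i _ => Finset.sum_congr rfl fun j _ => ?_
        simp
      rw [h2]
      rw [RCLike.star_def, RCLike.conj_re]
      exact (RCLike.nonneg_iff.mp this).1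
  have : Fact k.PosSemidef := ⟨hk⟩
  refine ⟨k, this, RKHS.kerFun _, fun x y ξ η => ?_⟩
  have h := RKHS.kernel_inner (H := RKHS.OfKernel k) y x ξ η
  rw [RKHS.OfKernel.kernel_ofKernel] at h
  rw [← h]
  change inner ℂ (Φ (star y * x) ξ) η = _
  rw [← ContinuousLinearMap.adjoint_inner_right, ← ContinuousLinearMap.star_eq_adjoint,
    ← Φ.map_star']
  simp

/-- Compression of a representation by a positive operator of its commutant is completely
positive. -/
theorem exists_completelyPositiveMap_eq_compress (π : X →⋆ₐ[ℂ] (K →L[ℂ] K)) (V : H →L[ℂ] K)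
    {Q : K →L[ℂ] K} (hQ : 0 ≤ Q) (hQπ : ∀ x, Q * π x = π x * Q) :
    ∃ Φ : X →CP (H →L[ℂ] H), ∀ x, Φ x = V.adjoint ∘L Q ∘L π x ∘L V := by
  let φ : X →ₗ[ℂ] (H →L[ℂ] H) :=
    { toFun := fun x => V.adjoint ∘L Q ∘L π x ∘L V
      map_add' := fun x y => by ext; simp
      map_smul' := fun c x => by ext; simp }
  have hstar : ∀ x, φ (star x) = star (φ x) := by
    intro x
    change V.adjoint ∘L Q ∘L π (star x) ∘L V = star (V.adjoint ∘L Q ∘L π x ∘L V)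
    have hQs : ContinuousLinearMap.adjoint Q = Q := hQ.isSelfAdjoint
    have h1 : Q ∘L (π x).adjoint = (π x).adjoint ∘L Q := by
      have := hQπ (star x)
      rwa [map_star] at this
    rw [map_star, ContinuousLinearMap.star_eq_adjoint, ContinuousLinearMap.star_eq_adjoint,
      ← ContinuousLinearMap.comp_assoc Q, h1]
    simp only [ContinuousLinearMap.adjoint_comp, ContinuousLinearMap.adjoint_adjoint, hQs]
    simp only [ContinuousLinearMap.comp_assoc]
  refine ⟨⟨φ, fun n A hA => ?_⟩, fun x => rfl⟩
  obtain ⟨B, rfl⟩ := CStarAlgebra.exists_eq_star_mul_self hA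
  refine CStarMatrix.nonneg_of_sum_inner_nonneg ?_ fun ξ => ?_
  · ext1 i j
    rw [CStarMatrix.star_apply, CStarMatrix.map_apply, CStarMatrix.map_apply, ← hstar,
      ← CStarMatrix.star_apply, star_mul, star_star]
  · have h : ∀ i j, inner ℂ (ξ i) (((star B * B).map φ) i j (ξ j)) =
        ∑ l, inner ℂ (π (B l i) (V (ξ i))) (Q (π (B l j) (V (ξ j)))) := by
      intro i j
      rw [CStarMatrix.map_apply, CStarMatrix.mul_apply, map_sum, sum_apply, inner_sum]
      refine Finset.sum_congr rfl fun l _ => ?_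
      change inner ℂ (ξ i) (V.adjoint (Q (π (star B i l * B l j) (V (ξ j))))) = _
      rw [ContinuousLinearMap.adjoint_inner_right, CStarMatrix.star_apply, map_mul, map_star,
        ← mul_apply_eq_comp, ← mul_assoc, ← map_star, hQπ, map_star, mul_assoc, mul_apply_eq_comp,
        ContinuousLinearMap.star_eq_adjoint, ContinuousLinearMap.adjoint_inner_right]
      rfl
    change 0 ≤ ∑ i, ∑ j, inner ℂ (ξ i) (((star B * B).map φ) i j (ξ j))
    simp_rw [h]
    -- The form is `∑ₗ ⟪vₗ, Q vₗ⟫` with `vₗ = ∑ᵢ π(Bₗᵢ) V ξᵢ`.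
    have h2 : ∑ i, ∑ j, ∑ l, inner ℂ (π (B l i) (V (ξ i))) (Q (π (B l j) (V (ξ j)))) =
        ∑ l, inner ℂ (∑ i, π (B l i) (V (ξ i))) (Q (∑ j, π (B l j) (V (ξ j)))) := by
      simp_rw [map_sum, sum_inner, inner_sum]
      rw [Finset.sum_congr rfl fun i _ => Finset.sum_comm, Finset.sum_comm]
    rw [h2]
    exact Finset.sum_nonneg fun l _ =>
      ((ContinuousLinearMap.nonneg_iff_isPositive Q).mp hQ).inner_nonneg_right _

end CompletelyPositive

end

section

/-! ### The Radon-Nikodym theorem for completely positive maps -/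

section RadonNikodym

variable {X : Type*} [CStarAlgebra X] [PartialOrder X] [StarOrderedRing X]
  {H : Type*} [NormedAddCommGroup H] [InnerProductSpace ℂ H] [CompleteSpace H]
  {K : Type*} [NormedAddCommGroup K] [InnerProductSpace ℂ K] [CompleteSpace K]
  {M : VonNeumannAlgebra H}

theorem ofReal_norm_sq_eq_inner (k : K) : ((‖k‖ ^ 2 : ℝ) : ℂ) = inner ℂ k k := by
  rw [inner_self_eq_norm_sq_to_K]
  push_cast
  rfl

theorem CPMap.coe_apply (T : CPMap X M) (x : X) :
    (T x : H →L[ℂ] H) = T.toCompletelyPositiveMap x := rfl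

namespace MinimalStinespring

variable {T : CPMap X M} (D : MinimalStinespring K T)

/-- The operator `V* R π(x) V`. -/
noncomputable def compress (R : K →L[ℂ] K) (x : X) : H →L[ℂ] H := D.V.adjoint ∘L R ∘L D.π x ∘L D.V

theorem inner_compress (R : K →L[ℂ] K) (x : X) (ξ η : H) :
    inner ℂ ξ (D.compress R x η) = inner ℂ (D.V ξ) (R (D.π x (D.V η))) := by
  simp [compress, ContinuousLinearMap.adjoint_inner_right]

theorem inner_π_left (x : X) (k l : K) : inner ℂ (D.π x k) l = inner ℂ k (D.π (star x) l) := by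
  rw [map_star, ContinuousLinearMap.star_eq_adjoint, ContinuousLinearMap.adjoint_inner_right]

theorem π_mul_apply (x y : X) (k : K) : D.π (x * y) k = D.π x (D.π y k) := by
  rw [map_mul]; rfl

theorem inner_of_commute {R : K →L[ℂ] K} (hR : ∀ x, R * D.π x = D.π x * R) (x y : X) (ξ η : H) :
    inner ℂ (D.π x (D.V ξ)) (R (D.π y (D.V η))) = inner ℂ ξ (D.compress R (star x * y) η) := by
  rw [inner_compress, inner_π_left, π_mul_apply, ← mul_apply_eq_comp (D.π (star x)), ← hR]
  rfl

theorem compress_one (x : X) : D.compress 1 x = T x := (D.eq_compress x).symm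

theorem inner_π (x y : X) (ξ η : H) :
    inner ℂ (D.π x (D.V ξ)) (D.π y (D.V η)) = inner ℂ ξ ((T (star x * y) : H →L[ℂ] H) η) := by
  rw [← D.compress_one, ← D.inner_of_commute (R := 1) (by simp)]
  rfl

/-- Linear combinations of the vectors `π(x) V ξ`. -/
noncomputable def combination : (X →₀ H) →ₗ[ℂ] K := Finsupp.lsum ℂ fun x => (D.π x ∘L D.V).toLinearMap

theorem combination_single (x : X) (ξ : H) :
    D.combination (Finsupp.single x ξ) = D.π x (D.V ξ) := by
  simp [combination]

theorem combination_apply (c : X →₀ H) :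
    D.combination c = c.sum fun x ξ => D.π x (D.V ξ) := by
  simp [combination, Function.comp_def]

theorem denseRange_combination : DenseRange D.combination := by
  have h : (LinearMap.range D.combination).topologicalClosure = ⊤ := by
    rw [eq_top_iff, ← D.dense]
    refine Submodule.topologicalClosure_mono (Submodule.span_le.mpr ?_)
    rintro k ⟨x, ξ, rfl⟩
    exact ⟨Finsupp.single x ξ, D.combination_single x ξ⟩
  have h2 := (Submodule.dense_iff_topologicalClosure_eq_top).mpr h
  exact h2

/-- The closed subspaces containing all `π(x) V ξ` are trivial. -/
theorem induction_on_dense {p : K → Prop} (hp : IsClosed {k | p k}) (hzero : p 0)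
    (hadd : ∀ k l, p k → p l → p (k + l)) (hgen : ∀ x ξ, p (D.π x (D.V ξ))) (k : K) : p k := by
  refine D.denseRange_combination.induction_on k hp fun c => ?_
  induction c using Finsupp.induction_linear with
  | zero => simpa using hzero
  | add f g hf hg => rw [map_add]; exact hadd _ _ hf hg
  | single x ξ => rw [combination_single]; exact hgen x ξ

theorem ext_of_inner {A B : K →L[ℂ] K} (h : ∀ x y ξ η, inner ℂ (D.π x (D.V ξ)) (A (D.π y (D.V η))) =
    inner ℂ (D.π x (D.V ξ)) (B (D.π y (D.V η)))) : A = B := by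
  ext l
  refine D.induction_on_dense (p := fun l => A l = B l)
    (isClosed_eq A.continuous B.continuous) (by simp)
    (fun k l hk hl => by rw [map_add, map_add, hk, hl]) (fun y η => ?_) l
  refine ext_inner_left ℂ fun k => ?_
  refine D.induction_on_dense
    (p := fun k => inner ℂ k (A (D.π y (D.V η))) = inner ℂ k (B (D.π y (D.V η))))
    (isClosed_eq (by fun_prop) (by fun_prop)) (by simp)
    (fun k l hk hl => by rw [inner_add_left, inner_add_left, hk, hl]) (fun x ξ => h x y ξ η) k

/-- For `R` in the commutant, `⟪π(x) V ξ, R π(y) V η⟫` only involves the compression of `R` at `x*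
y`. Identities between derivatives are checked this way. -/
theorem eq_of_compress_eq {A B : K →L[ℂ] K} (hA : ∀ x, A * D.π x = D.π x * A)
    (hB : ∀ x, B * D.π x = D.π x * B) (h : ∀ x, D.compress A x = D.compress B x) : A = B :=
  D.ext_of_inner fun x y ξ η => by rw [D.inner_of_commute hA, D.inner_of_commute hB, h]

/-- The hypothesis reads `‖∑ W x ξₓ‖ ≤ ‖∑ π(x) V ξₓ‖`, so `π(x) V ξ ↦ W x ξ` is well defined and
contractive on a dense subspace. It yields both the Radon-Nikodym derivatives and the lifts of
unitaries of `M'`. -/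
theorem exists_clm {F : Type*} [NormedAddCommGroup F] [InnerProductSpace ℂ F] [CompleteSpace F]
    (W : X → H →L[ℂ] F)
    (hW : ∀ c : X →₀ H, (c.sum fun x ξ => c.sum fun y η => inner ℂ (W x ξ) (W y η)) ≤
      c.sum fun x ξ => c.sum fun y η => inner ℂ ξ ((T (star x * y) : H →L[ℂ] H) η)) :
    ∃ A : K →L[ℂ] F, (∀ x ξ, A (D.π x (D.V ξ)) = W x ξ) ∧ ∀ k, ‖A k‖ ≤ ‖k‖ := by
  let f : (X →₀ H) →ₗ[ℂ] F := Finsupp.lsum ℂ fun x => (W x).toLinearMap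
  have hf : ∀ c, ((‖f c‖ ^ 2 : ℝ) : ℂ) =
      c.sum fun x ξ => c.sum fun y η => inner ℂ (W x ξ) (W y η) := by
    intro c
    have : f c = c.sum fun x ξ => W x ξ := by simp [f]
    rw [ofReal_norm_sq_eq_inner, this]
    simp_rw [Finsupp.sum, sum_inner, inner_sum]
  have he : ∀ c, ((‖D.combination c‖ ^ 2 : ℝ) : ℂ) =
      c.sum fun x ξ => c.sum fun y η => inner ℂ ξ ((T (star x * y) : H →L[ℂ] H) η) := by
    intro c
    rw [ofReal_norm_sq_eq_inner, combination_apply]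
    simp_rw [Finsupp.sum, sum_inner, inner_sum, inner_π]
  have hle : ∀ c, ‖f c‖ ≤ 1 * ‖D.combination c‖ := by
    intro c
    have := hW c
    rw [← hf, ← he] at this
    have h2 : ‖f c‖ ^ 2 ≤ ‖D.combination c‖ ^ 2 := by exact_mod_cast this
    rw [one_mul]
    exact le_of_sq_le_sq h2 (norm_nonneg _)
  refine ⟨f.extendOfNorm D.combination, fun x ξ => ?_, fun k => ?_⟩
  · rw [← D.combination_single, LinearMap.extendOfNorm_eq D.denseRange_combination ⟨1, hle⟩]
    simp [f]
  · simpa using LinearMap.norm_extendOfNorm_apply_le D.denseRange_combination 1 hle k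

/-- The Radon-Nikodym derivative of a completely positive map dominated by `T`. -/
theorem exists_radonNikodym {T₁ : CPMap X M} (h : T₁ ≤ T) :
    ∃ R : K →L[ℂ] K, 0 ≤ R ∧ R ≤ 1 ∧ (∀ x, R * D.π x = D.π x * R) ∧
      ∀ x, D.compress R x = T₁ x := by
  obtain ⟨T₂, hT₂⟩ := h
  obtain ⟨k, _, W, hW⟩ := T₁.toCompletelyPositiveMap.exists_kolmogorov
  -- Complete positivity of `T - T₁` makes the passage from `K` to the Kolmogorov space of `T₁` a
  -- contraction `A`; the derivative is `A* A`.
  obtain ⟨A, hA, hA1⟩ := D.exists_clm W fun c => by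
    have h0 := T₂.toCompletelyPositiveMap.finsupp_sum_inner_nonneg c
    simp_rw [hW]
    rw [← sub_nonneg]
    convert h0 using 1
    simp only [Finsupp.sum, ← Finset.sum_sub_distrib, ← inner_sub_right]
    refine Finset.sum_congr rfl fun x _ => Finset.sum_congr rfl fun y _ => ?_
    rw [← CPMap.coe_apply, ← CPMap.coe_apply, ← hT₂]
    rfl
  have hin : ∀ x y ξ η, inner ℂ (D.π x (D.V ξ)) ((A.adjoint ∘L A) (D.π y (D.V η))) =
      inner ℂ ξ ((T₁ (star x * y) : H →L[ℂ] H) η) := by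
    intro x y ξ η
    rw [ContinuousLinearMap.comp_apply, ContinuousLinearMap.adjoint_inner_right, hA, hA, hW]
    rfl
  -- Coefficients of `A* A` at `(y, z)` depend only on `y* z`, so `x` may be moved from one side to
  -- the other.
  have hcomm : ∀ x, (A.adjoint ∘L A) * D.π x = D.π x * (A.adjoint ∘L A) := by
    intro x
    refine D.ext_of_inner fun y z ξ η => ?_
    rw [mul_apply_eq_comp, mul_apply_eq_comp]
    change inner ℂ _ ((A.adjoint ∘L A) (D.π x (D.π z (D.V η)))) =
      inner ℂ _ (D.π x ((A.adjoint ∘L A) (D.π z (D.V η))))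
    rw [← D.π_mul_apply, hin]
    conv_rhs => rw [← star_star x, ← D.inner_π_left, ← D.π_mul_apply, hin, star_mul, star_star]
    rw [mul_assoc]
  refine ⟨A.adjoint ∘L A, ?_, ?_, hcomm, fun x => ?_⟩
  · rw [ContinuousLinearMap.nonneg_iff_isPositive]
    exact ContinuousLinearMap.isPositive_adjoint_comp_self A
  · rw [ContinuousLinearMap.le_def, ContinuousLinearMap.isPositive_def']
    refine ⟨(IsSelfAdjoint.one _).sub
      (ContinuousLinearMap.isPositive_adjoint_comp_self A).isSelfAdjoint, fun l => ?_⟩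
    rw [ContinuousLinearMap.reApplyInnerSelf_apply, sub_apply, inner_sub_left, map_sub,
      ContinuousLinearMap.comp_apply, ContinuousLinearMap.adjoint_inner_left,
      inner_self_eq_norm_sq]
    have h1 := hA1 l
    have : RCLike.re (inner ℂ ((1 : K →L[ℂ] K) l) l) = ‖l‖ ^ 2 := inner_self_eq_norm_sq l
    rw [this, sub_nonneg]
    gcongr
  · ext η
    refine ext_inner_left ℂ fun ξ => ?_
    have := D.inner_of_commute hcomm 1 x ξ η
    rw [hin] at this
    simpa using this.symm

end MinimalStinespring
end RadonNikodym

end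

/-! ### Values in `M` and orthogonality in terms of derivatives -/

section

/-- Writing `a = b* b`, conjugation of `a ≤ p` by `1 - p` gives `(b (1 - p))* (b (1 - p)) ≤ 0`. -/
theorem mul_eq_zero_of_le_of_isStarProjection {A : Type*} [CStarAlgebra A] [PartialOrder A]
    [StarOrderedRing A] {a p : A} (ha : 0 ≤ a) (hap : a ≤ p) (hp : IsStarProjection p) :
    a * (1 - p) = 0 := by
  obtain ⟨b, rfl⟩ := CStarAlgebra.exists_eq_star_mul_self ha
  have hq : star (1 - p) = 1 - p := hp.one_sub.isSelfAdjoint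
  have h1 : star (1 - p) * (star b * b) * (1 - p) ≤ 0 := by
    have := star_left_conjugate_le_conjugate hap (1 - p)
    rwa [mul_assoc _ p, hp.isIdempotentElem.mul_one_sub_self, mul_zero] at this
  have h2 : star (b * (1 - p)) * (b * (1 - p)) = 0 := by
    refine le_antisymm ?_ (star_mul_self_nonneg _)
    simpa only [star_mul, mul_assoc] using h1
  rw [mul_assoc, (CStarRing.star_mul_self_eq_zero_iff _).mp h2, mul_zero]

section RelativeCommutant

variable {X : Type*} [CStarAlgebra X] [PartialOrder X] [StarOrderedRing X]
  {H : Type*} [NormedAddCommGroup H] [InnerProductSpace ℂ H] [CompleteSpace H]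
  {K : Type*} [NormedAddCommGroup K] [InnerProductSpace ℂ K] [CompleteSpace K]
  {M : VonNeumannAlgebra H}

theorem VonNeumannAlgebra.isClosed (M : VonNeumannAlgebra H) : IsClosed (M : Set (H →L[ℂ] H)) := by
  rw [← M.centralizer_centralizer]
  exact Set.isClosed_centralizer _

/-- `M = M''`, and every element of the C*-algebra `M'` is a combination of four unitaries. -/
theorem VonNeumannAlgebra.mem_of_commute_unitary {a : H →L[ℂ] H}
    (h : ∀ u ∈ M.commutant, star u * u = 1 → u * star u = 1 → u * a = a * u) :
    a ∈ M.toStarSubalgebra := by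
  have : IsClosed (M.commutant.toStarSubalgebra : Set (H →L[ℂ] H)) := M.commutant.isClosed
  change a ∈ M
  rw [← M.commutant_commutant, mem_commutant_iff]
  intro g hg
  obtain ⟨u, c, hu, -⟩ :=
    CStarAlgebra.exists_sum_four_unitary (⟨g, hg⟩ : M.commutant.toStarSubalgebra)
  have hg' : g = ∑ i, c i • ((u i : M.commutant.toStarSubalgebra) : H →L[ℂ] H) := by
    simpa using congrArg (Subtype.val) hu
  rw [hg', Finset.sum_mul, Finset.mul_sum]
  refine Finset.sum_congr rfl fun i _ => ?_
  rw [smul_mul_assoc, mul_smul_comm]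
  congr 1
  exact h _ (u i : M.commutant.toStarSubalgebra).2
    (congrArg Subtype.val (Unitary.star_mul_self_of_mem (u i).2))
    (congrArg Subtype.val (Unitary.mul_star_self_of_mem (u i).2))

theorem CPMap.exists_add (T₁ T₂ : CPMap X M) :
    ∃ S : CPMap X M, ∀ x, S x = T₁ x + T₂ x := by
  refine ⟨⟨⟨T₁.toLinearMap + T₂.toLinearMap, fun k A hA => ?_⟩, fun x => ?_⟩, fun x => rfl⟩
  · exact add_nonneg (T₁.map_cstarMatrix_nonneg' k A hA) (T₂.map_cstarMatrix_nonneg' k A hA)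
  · exact add_mem (T₁.map_mem' x) (T₂.map_mem' x)

namespace MinimalStinespring

variable {T : CPMap X M} (D : MinimalStinespring K T)

/-- An isometry `u ∈ M'` commutes with every `T(x* y)`, so replacing `ξ` by `u ξ` preserves the
inner products of the vectors `π(x) V ξ`. This lifts `u` to `K`. -/
theorem exists_intertwiner {u : H →L[ℂ] H} (hu : u ∈ M.commutant) (hu1 : star u * u = 1) :
    ∃ W : K →L[ℂ] K, ∀ x ξ, W (D.π x (D.V ξ)) = D.π x (D.V (u ξ)) := by
  obtain ⟨W, hW, -⟩ := D.exists_clm (fun x => D.π x ∘L D.V ∘L u) fun c => by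
    refine le_of_eq ?_
    simp only [Finsupp.sum]
    refine Finset.sum_congr rfl fun x _ => Finset.sum_congr rfl fun y _ => ?_
    have h := VonNeumannAlgebra.mem_commutant_iff.mp hu _ (T (star x * y)).2
    change inner ℂ (D.π x (D.V (u (c x)))) (D.π y (D.V (u (c y)))) = _
    rw [D.inner_π, ← mul_apply_eq_comp _ u, h, mul_apply_eq_comp,
      ← ContinuousLinearMap.adjoint_inner_right, ← ContinuousLinearMap.star_eq_adjoint]
    change inner ℂ (c x) ((star u * u) _) = _
    rw [hu1]
    rfl
  exact ⟨W, hW⟩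

theorem inner_intertwiner {u : H →L[ℂ] H} (hu : u ∈ M.commutant)
    {W W' : K →L[ℂ] K} (hW : ∀ x ξ, W (D.π x (D.V ξ)) = D.π x (D.V (u ξ)))
    (hW' : ∀ x ξ, W' (D.π x (D.V ξ)) = D.π x (D.V (star u ξ))) : W.adjoint = W' := by
  refine D.ext_of_inner fun x y ξ η => ?_
  have h := VonNeumannAlgebra.mem_commutant_iff.mp (star_mem hu) _ (T (star x * y)).2
  rw [ContinuousLinearMap.adjoint_inner_right, hW, hW', D.inner_π, D.inner_π,
    ← mul_apply_eq_comp _ (star u), h, mul_apply_eq_comp, ContinuousLinearMap.star_eq_adjoint,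
    ContinuousLinearMap.adjoint_inner_right]

/-- The compression of `R` lies in `M` when it commutes with the unitaries `u` of `M'`, and the
coefficients of `R W` and `W R` are those of `compress R · u` and `u · compress R`. The second
condition is multiplicative in `R`, which is not apparent for the first. -/
theorem compress_mem_iff {R : K →L[ℂ] K} (hR : ∀ x, R * D.π x = D.π x * R) :
    (∀ x, D.compress R x ∈ M.toStarSubalgebra) ↔
      ∀ u ∈ M.commutant, star u * u = 1 → u * star u = 1 → ∀ W : K →L[ℂ] K,
        (∀ x ξ, W (D.π x (D.V ξ)) = D.π x (D.V (u ξ))) → R * W = W * R := by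
  have key : ∀ u ∈ M.commutant, star u * u = 1 → u * star u = 1 → ∀ W : K →L[ℂ] K,
        (∀ x ξ, W (D.π x (D.V ξ)) = D.π x (D.V (u ξ))) → ∀ x y ξ η,
        inner ℂ (D.π x (D.V ξ)) ((R * W) (D.π y (D.V η))) =
          inner ℂ ξ ((D.compress R (star x * y) * u) η) ∧
        inner ℂ (D.π x (D.V ξ)) ((W * R) (D.π y (D.V η))) =
          inner ℂ ξ ((u * D.compress R (star x * y)) η) := by
    intro u hu hu1 hu2 W hW x y ξ η
    obtain ⟨W', hW'⟩ := D.exists_intertwiner (star_mem hu) (by rwa [star_star])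
    have hadj := D.inner_intertwiner hu hW hW'
    constructor
    · rw [mul_apply_eq_comp, mul_apply_eq_comp, hW, D.inner_of_commute hR]
    · rw [mul_apply_eq_comp, mul_apply_eq_comp, ← ContinuousLinearMap.adjoint_inner_left, hadj, hW', D.inner_of_commute hR,
        ContinuousLinearMap.star_eq_adjoint, ContinuousLinearMap.adjoint_inner_left]
  constructor
  · intro h u hu hu1 hu2 W hW
    refine D.ext_of_inner fun x y ξ η => ?_
    rw [(key u hu hu1 hu2 W hW x y ξ η).1, (key u hu hu1 hu2 W hW x y ξ η).2,
      VonNeumannAlgebra.mem_commutant_iff.mp hu _ (h _)]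
  · intro h x
    refine VonNeumannAlgebra.mem_of_commute_unitary fun u hu hu1 hu2 => ?_
    obtain ⟨W, hW⟩ := D.exists_intertwiner hu hu1
    ext η
    refine ext_inner_left ℂ fun ξ => ?_
    have h1 := key u hu hu1 hu2 W hW 1 x ξ η
    rw [h u hu hu1 hu2 W hW] at h1
    simpa using h1.2.symm.trans h1.1

theorem compress_mul_mem {R₁ R₂ : K →L[ℂ] K} (hR₁ : ∀ x, R₁ * D.π x = D.π x * R₁)
    (hR₂ : ∀ x, R₂ * D.π x = D.π x * R₂) (h₁ : ∀ x, D.compress R₁ x ∈ M.toStarSubalgebra)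
    (h₂ : ∀ x, D.compress R₂ x ∈ M.toStarSubalgebra) (x : X) :
    D.compress (R₁ * R₂) x ∈ M.toStarSubalgebra := by
  rw [D.compress_mem_iff hR₁] at h₁
  rw [D.compress_mem_iff hR₂] at h₂
  refine (D.compress_mem_iff fun x => ?_).mpr (fun u hu hu1 hu2 W hW => ?_) x
  · rw [mul_assoc, hR₂, ← mul_assoc, hR₁, mul_assoc]
  · rw [mul_assoc, h₂ u hu hu1 hu2 W hW, ← mul_assoc, h₁ u hu hu1 hu2 W hW, mul_assoc]

theorem exists_cpMap_of_nonneg {Q : K →L[ℂ] K} (hQ : 0 ≤ Q) (hQπ : ∀ x, Q * D.π x = D.π x * Q)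
    (hQM : ∀ x, D.compress Q x ∈ M.toStarSubalgebra) :
    ∃ T' : CPMap X M, ∀ x, (T' x : H →L[ℂ] H) = D.compress Q x := by
  obtain ⟨Φ, hΦ⟩ := exists_completelyPositiveMap_eq_compress D.π D.V hQ hQπ
  exact ⟨⟨Φ, fun x => by
    have h := hQM x
    rwa [compress, ← hΦ x] at h⟩, hΦ⟩

theorem compress_add (A B : K →L[ℂ] K) (x : X) :
    D.compress (A + B) x = D.compress A x + D.compress B x := by
  ext; simp [compress]

theorem compress_sub (A B : K →L[ℂ] K) (x : X) :
    D.compress (A - B) x = D.compress A x - D.compress B x := by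
  ext; simp [compress]

/-- If two completely positive maps with Radon-Nikodym derivatives `R` and `1 - R` are
orthogonal, then `R` is a projection. -/
theorem mul_self_of_orthogonal {T₁ T₂ : CPMap X M} {R : K →L[ℂ] K} (hR0 : 0 ≤ R) (hR1 : R ≤ 1)
    (hR : ∀ x, R * D.π x = D.π x * R) (h₁ : ∀ x, D.compress R x = T₁ x)
    (h₂ : ∀ x, D.compress (1 - R) x = T₂ x) (h : T₁.Orthogonal T₂) : R * R = R := by
  have hR' : ∀ x, (1 - R) * D.π x = D.π x * (1 - R) := fun x => by
    rw [sub_mul, mul_sub, hR, one_mul, mul_one]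
  have hR1' : 0 ≤ 1 - R := sub_nonneg.mpr hR1
  have m₁ : ∀ x, D.compress R x ∈ M.toStarSubalgebra := fun x => h₁ x ▸ (T₁ x).2
  have m₂ : ∀ x, D.compress (1 - R) x ∈ M.toStarSubalgebra := fun x => h₂ x ▸ (T₂ x).2
  have hc : Commute R (1 - R) := (Commute.one_right R).sub_right (Commute.refl R)
  have hmul : ∀ {A B : K →L[ℂ] K}, (∀ x, A * D.π x = D.π x * A) → (∀ x, B * D.π x = D.π x * B) →
      ∀ x, A * B * D.π x = D.π x * (A * B) := fun hA hB x => by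
    rw [mul_assoc, hB, ← mul_assoc, hA, mul_assoc]
  -- The common minorant `T'` has derivative `R (1 - R)`. The differences `T₁ - T'` and `T₂ - T'`
  -- have derivatives `R²` and `(1 - R)²`.
  obtain ⟨T', hT'⟩ := D.exists_cpMap_of_nonneg (hc.mul_nonneg hR0 hR1') (hmul hR hR')
    (D.compress_mul_mem hR hR' m₁ m₂)
  obtain ⟨S₁, hS₁⟩ := D.exists_cpMap_of_nonneg ((Commute.refl R).mul_nonneg hR0 hR0) (hmul hR hR)
    (D.compress_mul_mem hR hR m₁ m₁)
  obtain ⟨S₂, hS₂⟩ := D.exists_cpMap_of_nonneg ((Commute.refl (1 - R)).mul_nonneg hR1' hR1')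
    (hmul hR' hR') (D.compress_mul_mem hR' hR' m₂ m₂)
  have hle₁ : T' ≤ T₁ := ⟨S₁, fun x => Subtype.ext <| by
    change (T₁ x : H →L[ℂ] H) - T' x = S₁ x
    rw [hT', hS₁, ← h₁, ← compress_sub, mul_sub, mul_one, sub_sub_cancel]⟩
  have hle₂ : T' ≤ T₂ := ⟨S₂, fun x => Subtype.ext <| by
    change (T₂ x : H →L[ℂ] H) - T' x = S₂ x
    rw [hT', hS₂, ← h₂, ← compress_sub, sub_mul 1 R, one_mul]⟩
  have h0 : R * (1 - R) = 0 := by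
    refine D.eq_of_compress_eq (hmul hR hR') (by simp) fun x => ?_
    rw [← hT', h T' hle₁ hle₂ x]
    ext; simp [compress]
  rw [mul_sub, mul_one, sub_eq_zero] at h0
  exact h0.symm

/-- Completely positive maps whose Radon-Nikodym derivatives are complementary projections are
orthogonal. -/
theorem orthogonal_of_mul_self {T₁ T₂ : CPMap X M} {R : K →L[ℂ] K} (hR : IsStarProjection R)
    (hRπ : ∀ x, R * D.π x = D.π x * R)
    (h₁ : ∀ x, D.compress R x = T₁ x) (h₂ : ∀ x, D.compress (1 - R) x = T₂ x) :
    T₁.Orthogonal T₂ := by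
  intro T' ⟨S₁, hS₁⟩ ⟨S₂, hS₂⟩ x
  have hT : ∀ x, (T x : H →L[ℂ] H) = T₁ x + T₂ x := fun x => by
    rw [← h₁, ← h₂, ← compress_add, add_sub_cancel, compress_one]
  have hS₁' : ∀ x, (T₁ x : H →L[ℂ] H) - T' x = S₁ x := fun x => congrArg Subtype.val (hS₁ x)
  have hS₂' : ∀ x, (T₂ x : H →L[ℂ] H) - T' x = S₂ x := fun x => congrArg Subtype.val (hS₂ x)
  have le_of_add : ∀ {A B C : CPMap X M},
      (∀ x, (T x : H →L[ℂ] H) = A x + (B x + C x)) → A ≤ T := fun {A B C} hABC => by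
    obtain ⟨E, hE⟩ := CPMap.exists_add B C
    exact ⟨E, fun x => Subtype.ext <| by
      rw [hE]
      change (T x : H →L[ℂ] H) - A x = B x + C x
      rw [hABC, add_sub_cancel_left]⟩
  -- Since `T = T₁ + T₂`, each of `T'`, `T₁ - T'`, `T₂ - T'` is dominated by `T`. By uniqueness the
  -- last two have derivatives `R - R'` and `1 - R - R'`, which are therefore positive.
  obtain ⟨R', hR'0, -, hR'π, hR'⟩ := D.exists_radonNikodym
    (le_of_add (A := T') (B := S₁) (C := T₂) fun x => by rw [hT, ← hS₁']; abel)
  obtain ⟨Q₁, hQ₁0, -, hQ₁π, hQ₁⟩ := D.exists_radonNikodym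
    (le_of_add (A := S₁) (B := T') (C := T₂) fun x => by rw [hT, ← hS₁']; abel)
  obtain ⟨Q₂, hQ₂0, -, hQ₂π, hQ₂⟩ := D.exists_radonNikodym
    (le_of_add (A := S₂) (B := T') (C := T₁) fun x => by rw [hT, ← hS₂']; abel)
  have e₁ : Q₁ = R - R' := D.eq_of_compress_eq hQ₁π
    (fun x => by rw [sub_mul, mul_sub, hRπ, hR'π]) fun x => by
      rw [hQ₁, compress_sub, h₁, hR', hS₁']
  have e₂ : Q₂ = 1 - R - R' := D.eq_of_compress_eq hQ₂π
    (fun x => by rw [sub_mul, mul_sub, sub_mul, mul_sub, hRπ, hR'π, one_mul, mul_one]) fun x => by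
      rw [hQ₂, compress_sub, h₂, hR', hS₂']
  have l₁ : R' ≤ R := sub_nonneg.mp (e₁ ▸ hQ₁0)
  have l₂ : R' ≤ 1 - R := sub_nonneg.mp (e₂ ▸ hQ₂0)
  have z₁ := mul_eq_zero_of_le_of_isStarProjection hR'0 l₂ hR.one_sub
  have z₂ := mul_eq_zero_of_le_of_isStarProjection hR'0 l₁ hR
  rw [sub_sub_cancel] at z₁
  have : R' = 0 := by rw [← mul_one R', ← add_sub_cancel R 1, mul_add, z₁, z₂, add_zero]
  refine Subtype.ext ?_
  rw [← hR', this]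
  ext; simp [compress]

end MinimalStinespring
end RelativeCommutant

end

section

/-! ### Integration of essentially bounded functions against an operator measure -/

section LInfty

variable {S : Type*} [MeasurableSpace S] {ν : Measure S}

/-- By compactness, finitely many `ε`-balls around a dense sequence cover the closed ball of radius
`C`; `f` sends `s` to the nearest of finitely many terms of the sequence. -/
theorem MeasureTheory.SimpleFunc.exists_uniform_approx (g : S → ℂ) (hg : Measurable g) (C : ℝ)
    {ε : ℝ} (hε : 0 < ε) :
    ∃ f : SimpleFunc S ℂ, ∀ s, ‖g s‖ ≤ C → ‖g s - f s‖ ≤ ε := by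
  let e := TopologicalSpace.denseSeq ℂ
  have he : DenseRange e := TopologicalSpace.denseRange_denseSeq ℂ
  obtain ⟨t, ht⟩ := (isCompact_closedBall (0 : ℂ) C).elim_finite_subcover
    (fun n => Metric.ball (e n) ε) (fun n => Metric.isOpen_ball) fun z _ => by
      obtain ⟨n, hn⟩ := he.exists_dist_lt z hε
      exact Set.mem_iUnion.mpr ⟨n, Metric.mem_ball.mpr hn⟩
  obtain ⟨N, hN⟩ := t.exists_le
  refine ⟨(SimpleFunc.nearestPt e N).comp g hg, fun s hs => ?_⟩
  obtain ⟨n, hnt, hn⟩ := Set.mem_iUnion₂.mp (ht (show g s ∈ Metric.closedBall 0 C by simpa using hs))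
  have h1 := SimpleFunc.edist_nearestPt_le e (g s) (hN n hnt)
  rw [edist_dist, edist_dist, ENNReal.ofReal_le_ofReal_iff dist_nonneg] at h1
  rw [← dist_eq_norm, dist_comm]
  exact h1.trans (by rw [dist_comm]; exact (Metric.mem_ball.mp hn).le)

namespace MeasureTheory

variable (ν) in
/-- The class in `L^∞` of a simple function. -/
noncomputable def SimpleFunc.toLinfty : SimpleFunc S ℂ →ₗ[ℂ] Lp ℂ ∞ ν where
  toFun f := (f.memLp_top ν).toLp f
  map_add' _ _ := rfl
  map_smul' _ _ := rfl

theorem SimpleFunc.coeFn_toLinfty (f : SimpleFunc S ℂ) : f.toLinfty ν =ᵐ[ν] f :=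
  MemLp.coeFn_toLp (f.memLp_top ν)

theorem Lp.ae_norm_le_norm_top (f : Lp ℂ ∞ ν) : ∀ᵐ s ∂ν, ‖f s‖ ≤ ‖f‖ := by
  have h := ae_le_eLpNormEssSup (f := f) (μ := ν)
  filter_upwards [h] with s hs
  have h2 : eLpNormEssSup f ν ≠ ∞ := by
    rw [← eLpNorm_exponent_top]; exact Lp.eLpNorm_ne_top f
  rw [Lp.norm_def, eLpNorm_exponent_top, ← toReal_enorm]
  exact ENNReal.toReal_mono h2 hs

theorem Lp.norm_le_of_ae_bound_top {f : Lp ℂ ∞ ν} {C : ℝ} (hC : 0 ≤ C)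
    (h : ∀ᵐ s ∂ν, ‖f s‖ ≤ C) : ‖f‖ ≤ C := by
  rw [Lp.norm_def, eLpNorm_exponent_top]
  exact ENNReal.toReal_le_of_le_ofReal hC (eLpNormEssSup_le_of_ae_bound h)

theorem SimpleFunc.denseRange_toLinfty : DenseRange (SimpleFunc.toLinfty (S := S) ν) := by
  intro g
  rw [Metric.mem_closure_iff]
  intro ε hε
  obtain ⟨f, hf⟩ := SimpleFunc.exists_uniform_approx g (Lp.stronglyMeasurable g).measurable ‖g‖
    (half_pos hε)
  refine ⟨_, ⟨f, rfl⟩, ?_⟩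
  rw [dist_eq_norm]
  refine lt_of_le_of_lt (Lp.norm_le_of_ae_bound_top (half_pos hε).le ?_) (half_lt_self hε)
  filter_upwards [Lp.coeFn_sub g (f.toLinfty ν), f.coeFn_toLinfty, Lp.ae_norm_le_norm_top g]
    with s h1 h2 h3
  rw [h1, Pi.sub_apply, h2]
  exact hf s h3

theorem SimpleFunc.toLinfty_eq_sum [IsFiniteMeasure ν] (f : SimpleFunc S ℂ) :
    f.toLinfty ν = ∑ c ∈ f.range,
      indicatorConstLp ∞ (f.measurableSet_fiber c) (measure_ne_top ν _) c := by
  have h : f = ∑ c ∈ f.range, (SimpleFunc.const S c).piecewise (f ⁻¹' {c})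
      (f.measurableSet_fiber c) (SimpleFunc.const S 0) := by
    ext s
    have hs : ∀ t : Finset ℂ, (∑ c ∈ t, (SimpleFunc.const S c).piecewise (f ⁻¹' {c})
        (f.measurableSet_fiber c) (SimpleFunc.const S 0)) s = ∑ c ∈ t, if f s = c then c else 0 := by
      intro t
      induction t using Finset.induction_on with
      | empty => rfl
      | insert c t hc ih =>
        rw [Finset.sum_insert hc, Finset.sum_insert hc, SimpleFunc.add_apply, ih]
        congr 1
    rw [hs, Finset.sum_ite_eq, if_pos (f.mem_range_self s)]
  conv_lhs => rw [h, map_sum]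
  rfl

/-- Simple functions are dense in the `L^∞` norm, and a simple function is a finite sum of multiples
of indicators. -/
theorem Lp.induction_top [IsFiniteMeasure ν] {p : Lp ℂ ∞ ν → Prop} (hp : IsClosed {f | p f})
    (hadd : ∀ f g, p f → p g → p (f + g))
    (hind : ∀ (Δ : Set S) (hΔ : MeasurableSet Δ) (c : ℂ),
      p (indicatorConstLp ∞ hΔ (measure_ne_top ν Δ) c)) (f : Lp ℂ ∞ ν) : p f := by
  refine SimpleFunc.denseRange_toLinfty.induction_on f hp fun f => ?_
  rw [SimpleFunc.toLinfty_eq_sum]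
  refine Finset.sum_induction _ p hadd ?_ fun c _ => hind _ _ c
  simpa using hind ∅ MeasurableSet.empty 0

end MeasureTheory

variable {K : Type*} [NormedAddCommGroup K] [InnerProductSpace ℂ K] [CompleteSpace K]

/-- A finitely additive, positive operator valued measure that vanishes on the null sets
of `ν`. -/
structure IsPOVM (ν : Measure S) (P : Set S → K →L[ℂ] K) : Prop where
  nonneg : ∀ Δ, MeasurableSet Δ → 0 ≤ P Δ
  union : ∀ Δ Δ', MeasurableSet Δ → MeasurableSet Δ' → Disjoint Δ Δ' → P (Δ ∪ Δ') = P Δ + P Δ'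
  univ : P Set.univ = 1
  null : ∀ Δ, MeasurableSet Δ → ν Δ = 0 → P Δ = 0

namespace IsPOVM

variable {P : Set S → K →L[ℂ] K} (hP : IsPOVM ν P)
include hP

theorem empty : P ∅ = 0 := hP.null ∅ MeasurableSet.empty measure_empty

theorem sum_fiber (f : SimpleFunc S ℂ) : ∑ c ∈ f.range, P (f ⁻¹' {c}) = 1 := by
  have h : ∀ t : Finset ℂ, ∑ c ∈ t, P (f ⁻¹' {c}) = P (f ⁻¹' t) := by
    intro t
    induction t using Finset.induction_on with
    | empty => simp [hP.empty]
    | insert c t hc ih =>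
      rw [Finset.sum_insert hc, ih, ← hP.union _ _ (f.measurableSet_fiber c)
        (f.measurableSet_preimage _), Finset.coe_insert, Set.insert_eq, Set.preimage_union]
      exact Disjoint.preimage _ (by simpa using hc)
  rw [h, ← hP.univ]
  congr 1
  ext s; simp

theorem norm_inner_le {Δ : Set S} (hΔ : MeasurableSet Δ) (k l : K) :
    ‖(inner ℂ k (P Δ l) : ℂ)‖ ≤
      √(RCLike.re (inner ℂ k (P Δ k) : ℂ)) * √(RCLike.re (inner ℂ l (P Δ l) : ℂ)) := by
  obtain ⟨b, hb⟩ := CStarAlgebra.exists_eq_star_mul_self (hP.nonneg Δ hΔ)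
  have h : ∀ k l, inner ℂ k (P Δ l) = inner ℂ (b k) (b l) := fun k l => by
    rw [hb, mul_apply_eq_comp, ContinuousLinearMap.star_eq_adjoint,
      ContinuousLinearMap.adjoint_inner_right]
  rw [h, h, h, inner_self_eq_norm_sq, inner_self_eq_norm_sq, Real.sqrt_sq (norm_nonneg _),
    Real.sqrt_sq (norm_nonneg _)]
  exact norm_inner_le_norm _ _

theorem re_inner_nonneg {Δ : Set S} (hΔ : MeasurableSet Δ) (k : K) :
    0 ≤ RCLike.re (inner ℂ k (P Δ k) : ℂ) :=
  (RCLike.nonneg_iff.mp (((ContinuousLinearMap.nonneg_iff_isPositive _).mp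
    (hP.nonneg Δ hΔ)).inner_nonneg_right k)).1

theorem sum_re_inner_fiber (f : SimpleFunc S ℂ) (k : K) :
    ∑ c ∈ f.range, RCLike.re (inner ℂ k (P (f ⁻¹' {c}) k) : ℂ) = ‖k‖ ^ 2 := by
  rw [← map_sum, ← inner_sum, ← sum_apply, hP.sum_fiber, ← inner_self_eq_norm_sq (𝕜 := ℂ)]
  rfl

/-- Apply Cauchy-Schwarz to each form `⟪·, P(f⁻¹{c}) ·⟫` and then to the sum over `c`, using that
the `P(f⁻¹{c})` add up to `1`. Values `c` larger than the essential supremum occur on null fibres,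
where `P` vanishes. -/
theorem norm_sum_fiber_le (f : SimpleFunc S ℂ) :
    ‖∑ c ∈ f.range, c • P (f ⁻¹' {c})‖ ≤ ‖f.toLinfty ν‖ := by
  set C := ‖f.toLinfty ν‖ with hC
  have hC0 : 0 ≤ C := norm_nonneg _
  have h1 : ∀ c, ‖c‖ ≤ C ∨ P (f ⁻¹' {c}) = 0 := by
    intro c
    by_contra! h
    refine h.2 (hP.null _ (f.measurableSet_fiber c) ?_)
    have h2 : ∀ᵐ s ∂ν, f s ≠ c := by
      filter_upwards [Lp.ae_norm_le_norm_top (f.toLinfty ν), f.coeFn_toLinfty] with s hs hs' hsc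
      rw [hs', hsc] at hs
      exact absurd hs (not_le.mpr h.1)
    simpa [ae_iff, Set.preimage, Set.mem_singleton_iff] using h2
  refine ContinuousLinearMap.opNorm_le_bound _ hC0 fun l => ?_
  set k := (∑ c ∈ f.range, c • P (f ⁻¹' {c})) l with hk
  have h3 : ∀ k l : K, ‖(inner ℂ k ((∑ c ∈ f.range, c • P (f ⁻¹' {c})) l) : ℂ)‖ ≤
      C * (‖k‖ * ‖l‖) := by
    intro k l
    rw [sum_apply, inner_sum]
    calc ‖∑ c ∈ f.range, inner ℂ k ((c • P (f ⁻¹' {c})) l)‖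
        ≤ ∑ c ∈ f.range, C * (√(RCLike.re (inner ℂ k (P (f ⁻¹' {c}) k) : ℂ)) *
            √(RCLike.re (inner ℂ l (P (f ⁻¹' {c}) l) : ℂ))) := by
          refine norm_sum_le_of_le _ fun c _ => ?_
          rcases h1 c with h | h
          · rw [smul_apply, inner_smul_right, norm_mul]
            exact mul_le_mul h (hP.norm_inner_le (f.measurableSet_fiber c) k l) (norm_nonneg _) hC0
          · simp [h]
      _ ≤ C * (‖k‖ * ‖l‖) := by
          rw [← Finset.mul_sum]
          refine mul_le_mul_of_nonneg_left ?_ hC0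
          refine (Real.sum_sqrt_mul_sqrt_le _ (fun c => hP.re_inner_nonneg (f.measurableSet_fiber c) k)
            (fun c => hP.re_inner_nonneg (f.measurableSet_fiber c) l)).trans ?_
          rw [hP.sum_re_inner_fiber, hP.sum_re_inner_fiber, Real.sqrt_sq (norm_nonneg _),
            Real.sqrt_sq (norm_nonneg _)]
  -- With `k` the image of `l`, this reads `‖k‖² ≤ C ‖k‖ ‖l‖`.
  have h4 := h3 k l
  rw [← hk, ← ofReal_norm_sq_eq_inner, Complex.norm_real, Real.norm_of_nonneg (by positivity)] at h4
  by_cases hk0 : ‖k‖ = 0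
  · rw [hk0]; positivity
  · have : 0 < ‖k‖ := lt_of_le_of_ne (norm_nonneg _) (Ne.symm hk0)
    nlinarith

/-- Finite additivity defines the integral on simple functions; the uniform bound extends it to
`L^∞`. No `σ`-additivity is involved. -/
theorem exists_integral [IsFiniteMeasure ν] : ∃ κ : Lp ℂ ∞ ν →L[ℂ] (K →L[ℂ] K),
    ∀ (Δ : Set S) (hΔ : MeasurableSet Δ) (c : ℂ),
      κ (indicatorConstLp ∞ hΔ (measure_ne_top ν Δ) c) = c • P Δ := by
  let Tm : Set S → ℂ →L[ℝ] (K →L[ℂ] K) := fun Δ =>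
    ((ContinuousLinearMap.id ℂ ℂ).smulRight (P Δ)).restrictScalars ℝ
  have hTm : FinMeasAdditive ν Tm := fun s t hs ht _ _ hd => by
    ext1 c
    simp [Tm, hP.union s t hs ht hd]
  have hint : ∀ f : SimpleFunc S ℂ, Integrable f ν := fun f => SimpleFunc.integrable_of_isFiniteMeasure f
  let g : SimpleFunc S ℂ →ₗ[ℂ] (K →L[ℂ] K) :=
    { toFun := fun f => f.setToSimpleFunc Tm
      map_add' := fun f f' => SimpleFunc.setToSimpleFunc_add Tm hTm (hint f) (hint f')
      map_smul' := fun c f => SimpleFunc.setToSimpleFunc_smul Tm hTm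
        (fun c s x => by simp [Tm, mul_smul]) c (hint f) }
  have hg : ∀ f, ‖g f‖ ≤ 1 * ‖f.toLinfty ν‖ := fun f => by
    rw [one_mul]
    exact hP.norm_sum_fiber_le f
  refine ⟨g.extendOfNorm (SimpleFunc.toLinfty ν), fun Δ hΔ c => ?_⟩
  have h1 : indicatorConstLp ∞ hΔ (measure_ne_top ν Δ) c = SimpleFunc.toLinfty ν
      ((SimpleFunc.const S c).piecewise Δ hΔ (SimpleFunc.const S 0)) := rfl
  rw [h1, LinearMap.extendOfNorm_eq SimpleFunc.denseRange_toLinfty ⟨1, hg⟩]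
  change SimpleFunc.setToSimpleFunc Tm _ = _
  rw [SimpleFunc.setToSimpleFunc_indicator Tm hTm.map_empty_eq_zero hΔ]
  simp [Tm]

end IsPOVM
end LInfty

end

/-! ### Products in `L^∞` and integrals against complex measures -/

section

section LInftyAlgebra

variable {S : Type*} [MeasurableSpace S] {ν : Measure S}

namespace MeasureTheory

theorem Lp.star_indicatorConstLp_top [IsFiniteMeasure ν] {Δ : Set S} (hΔ : MeasurableSet Δ) (c : ℂ) :
    star (indicatorConstLp ∞ hΔ (measure_ne_top ν Δ) c) =
      indicatorConstLp ∞ hΔ (measure_ne_top ν Δ) (star c) := by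
  refine Lp.ext ?_
  filter_upwards [Lp.coeFn_star (indicatorConstLp ∞ hΔ (measure_ne_top ν Δ) c),
    indicatorConstLp_coeFn (p := ∞) (hs := hΔ) (hμs := measure_ne_top ν Δ) (c := c),
    indicatorConstLp_coeFn (p := ∞) (hs := hΔ) (hμs := measure_ne_top ν Δ) (c := star c)]
    with s h1 h2 h3
  rw [h1, h3, Pi.star_apply, h2]
  by_cases hs : s ∈ Δ <;> simp [hs]

theorem Lp.indicatorConstLp_smul_top [IsFiniteMeasure ν] {Δ Δ' : Set S} (hΔ : MeasurableSet Δ)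
    (hΔ' : MeasurableSet Δ') (c c' : ℂ) :
    (indicatorConstLp ∞ hΔ (measure_ne_top ν Δ) c •
      indicatorConstLp ∞ hΔ' (measure_ne_top ν Δ') c' : Lp ℂ ∞ ν) =
      indicatorConstLp ∞ (hΔ.inter hΔ') (measure_ne_top ν _) (c * c') := by
  refine Lp.ext ?_
  filter_upwards [Lp.coeFn_lpSMul (r := ∞) (indicatorConstLp ∞ hΔ (measure_ne_top ν Δ) c)
      (indicatorConstLp ∞ hΔ' (measure_ne_top ν Δ') c'),
    indicatorConstLp_coeFn (p := ∞) (hs := hΔ) (hμs := measure_ne_top ν Δ) (c := c),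
    indicatorConstLp_coeFn (p := ∞) (hs := hΔ') (hμs := measure_ne_top ν Δ') (c := c'),
    indicatorConstLp_coeFn (p := ∞) (hs := hΔ.inter hΔ') (hμs := measure_ne_top ν _) (c := c * c')]
    with s h1 h2 h3 h4
  rw [h1, h4, Pi.smul_apply', h2, h3]
  by_cases hs : s ∈ Δ <;> by_cases hs' : s ∈ Δ' <;> simp [hs, hs']

theorem Lp.smul_comm_top (f g : Lp ℂ ∞ ν) : (f • g : Lp ℂ ∞ ν) = g • f := by
  refine Lp.ext ?_
  filter_upwards [Lp.coeFn_lpSMul (r := ∞) f g, Lp.coeFn_lpSMul (r := ∞) g f] with s h1 h2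
  rw [h1, h2, Pi.smul_apply', Pi.smul_apply', smul_eq_mul, smul_eq_mul, mul_comm]

theorem Lp.continuous_smul_right_top (f : Lp ℂ ∞ ν) :
    Continuous fun g : Lp ℂ ∞ ν => (f • g : Lp ℂ ∞ ν) := by
  exact AddMonoidHomClass.continuous_of_bound
    (AddMonoidHom.mk' (fun g : Lp ℂ ∞ ν => (f • g : Lp ℂ ∞ ν)) fun g g' => Lp.add_smul f g g') ‖f‖
    fun g => Lp.norm_smul_le f g

/-- Some set `Δ = {|g| > 1/(n+1)}` has positive measure, and `h = 1_Δ g⁻¹` is bounded by `n + 1`.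
Injectivity of a multiplicative map thereby reduces to indicators. -/
theorem Lp.exists_smul_eq_indicatorConstLp [IsFiniteMeasure ν] {g : Lp ℂ ∞ ν} (hg : g ≠ 0) :
    ∃ (Δ : Set S) (hΔ : MeasurableSet Δ), ν Δ ≠ 0 ∧ ∃ h : Lp ℂ ∞ ν,
      (h • g : Lp ℂ ∞ ν) = indicatorConstLp ∞ hΔ (measure_ne_top ν Δ) 1 := by
  have hgm : Measurable g := (Lp.stronglyMeasurable g).measurable
  obtain ⟨n, hn⟩ : ∃ n : ℕ, ν {s | 1 / ((n : ℝ) + 1) < ‖g s‖} ≠ 0 := by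
    by_contra! h
    refine hg (Lp.ext ?_)
    have h2 := ae_all_iff.mpr fun n : ℕ => (ae_iff (p := fun s => ¬ 1 / ((n : ℝ) + 1) < ‖g s‖)).mpr
      (by simpa using h n)
    filter_upwards [h2, Lp.coeFn_zero ℂ ∞ ν] with s hs h0
    rw [h0, Pi.zero_apply]
    by_contra hne
    obtain ⟨n, hn⟩ := exists_nat_one_div_lt (norm_pos_iff.mpr hne)
    exact hs n hn
  set Δ := {s | 1 / ((n : ℝ) + 1) < ‖g s‖}
  have hΔ : MeasurableSet Δ := measurableSet_lt measurable_const hgm.norm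
  have hmem : MemLp (Δ.indicator fun s => (g s)⁻¹) ∞ ν := by
    refine memLp_top_of_bound (hgm.inv.indicator hΔ).aestronglyMeasurable ((n : ℝ) + 1)
      (Filter.Eventually.of_forall fun s => ?_)
    by_cases hs : s ∈ Δ
    · rw [Set.indicator_of_mem hs, norm_inv]
      have : 1 / ((n : ℝ) + 1) < ‖g s‖ := hs
      rw [one_div] at this
      exact inv_le_of_inv_le₀ (by positivity) this.le
    · rw [Set.indicator_of_notMem hs]; simp; positivity
  refine ⟨Δ, hΔ, hn, hmem.toLp, Lp.ext ?_⟩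
  filter_upwards [Lp.coeFn_lpSMul (r := ∞) hmem.toLp g, hmem.coeFn_toLp,
    indicatorConstLp_coeFn (p := ∞) (hs := hΔ) (hμs := measure_ne_top ν Δ) (c := (1 : ℂ))]
    with s h1 h2 h3
  rw [h1, h3, Pi.smul_apply', h2, smul_eq_mul]
  by_cases hs : s ∈ Δ
  · rw [Set.indicator_of_mem hs, Set.indicator_of_mem hs, inv_mul_cancel₀]
    have h4 : 1 / ((n : ℝ) + 1) < ‖g s‖ := hs
    exact norm_pos_iff.mp (lt_trans (by positivity) h4)
  · rw [Set.indicator_of_notMem hs, Set.indicator_of_notMem hs, zero_mul]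

end MeasureTheory

section VectorIntegral

theorem MeasureTheory.ComplexMeasure.isFiniteMeasure_variation (m : ComplexMeasure S) :
    IsFiniteMeasure m.variation := by
  have h : m.variation ≤ (ComplexMeasure.re m).totalVariation + (ComplexMeasure.im m).totalVariation := by
    refine VectorMeasure.variation_le_of_forall_enorm_le fun E hE => ?_
    have h1 := (ComplexMeasure.re m).enorm_le_totalVariation E
    have h2 := (ComplexMeasure.im m).enorm_le_totalVariation E
    refine le_trans ?_ (add_le_add h1 h2)
    have h3 : m E = ((ComplexMeasure.re m E : ℝ) : ℂ) + (ComplexMeasure.im m E : ℝ) * Complex.I :=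
      (Complex.re_add_im (m E)).symm
    rw [h3]
    refine (enorm_add_le _ _).trans (add_le_add ?_ ?_)
    · exact (enorm_eq_iff_norm_eq.mpr (Complex.norm_real _)).le
    · refine (enorm_eq_iff_norm_eq.mpr ?_).le
      rw [norm_mul, Complex.norm_I, mul_one, Complex.norm_real]
  exact isFiniteMeasure_of_le _ h

theorem MeasureTheory.ComplexMeasure.variation_absolutelyContinuous {m : ComplexMeasure S}
    (hm : ∀ Δ, MeasurableSet Δ → ν Δ = 0 → m Δ = 0) : m.variation ≪ ν := by
  refine Measure.AbsolutelyContinuous.mk fun Δ hΔ h0 => ?_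
  rw [VectorMeasure.variation_apply_eq_zero hΔ]
  exact fun t ht htm => hm t htm (measure_mono_null ht h0)

/-- Both sides are additive, continuous in the `L^∞` norm, and agree on indicators. Essential bounds
with respect to `ν` pass to the variation of `m`, which is finite and absolutely continuous. -/
theorem MeasureTheory.ComplexMeasure.eq_integral_of_indicator [IsFiniteMeasure ν] {m : ComplexMeasure S}
    (hm : ∀ Δ, MeasurableSet Δ → ν Δ = 0 → m Δ = 0) (φ : Lp ℂ ∞ ν →L[ℂ] ℂ)
    (hφ : ∀ (Δ : Set S) (hΔ : MeasurableSet Δ) (c : ℂ),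
      φ (indicatorConstLp ∞ hΔ (measure_ne_top ν Δ) c) = c * m Δ) (f : Lp ℂ ∞ ν) :
    φ f = ∫ᵛ s, f s ∂[ContinuousLinearMap.mul ℝ ℂ; m] := by
  have hfin := m.isFiniteMeasure_variation
  have hac := m.variation_absolutelyContinuous hm
  have hint : ∀ f : Lp ℂ ∞ ν, m.Integrable f := fun f =>
    Integrable.of_bound ((Lp.aestronglyMeasurable f).mono_ac hac) ‖f‖
      (hac.ae_le (Lp.ae_norm_le_norm_top f))
  let I : Lp ℂ ∞ ν →+ ℂ := AddMonoidHom.mk'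
    (fun f => ∫ᵛ s, f s ∂[ContinuousLinearMap.mul ℝ ℂ; m]) fun f g => by
      rw [← VectorMeasure.integral_fun_add (hint f) (hint g)]
      exact VectorMeasure.integral_congr_ae (hac.ae_le (Lp.coeFn_add f g))
  have hI : Continuous I := by
    refine AddMonoidHomClass.continuous_of_bound I
      (‖ContinuousLinearMap.mul ℝ ℂ‖ * m.variation.real Set.univ) fun f => ?_
    refine (VectorMeasure.norm_integral_le_of_norm_le_const
      (hac.ae_le (Lp.ae_norm_le_norm_top f))).trans_eq ?_
    ring
  refine Lp.induction_top (p := fun f => φ f = I f) (isClosed_eq φ.continuous hI)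
    (fun f g hf hg => by rw [map_add, map_add, hf, hg]) (fun Δ hΔ c => ?_) f
  rw [hφ]
  refine Eq.trans ?_ (VectorMeasure.integral_congr_ae (hac.ae_le indicatorConstLp_coeFn)).symm
  rw [VectorMeasure.integral_indicator hΔ, VectorMeasure.setIntegral_const]
  simp

end VectorIntegral
end LInftyAlgebra

end

/-! ### Projection valued measures and multiplicativity of the integral -/

section

theorem MeasureTheory.Lp.star_add_top {S : Type*} [MeasurableSpace S] {ν : Measure S}
    (f g : Lp ℂ ∞ ν) : star (f + g) = star f + star g := by
  refine Lp.ext ?_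
  filter_upwards [Lp.coeFn_star (f + g), Lp.coeFn_add f g, Lp.coeFn_add (star f) (star g),
    Lp.coeFn_star f, Lp.coeFn_star g] with s h1 h2 h3 h4 h5
  rw [h1, h3, Pi.star_apply, h2, Pi.add_apply, Pi.add_apply, h4, h5, star_add]; rfl

theorem MeasureTheory.Lp.continuous_star_top {S : Type*} [MeasurableSpace S] {ν : Measure S} :
    Continuous fun f : Lp ℂ ∞ ν => star f :=
  AddMonoidHomClass.continuous_of_bound
    (AddMonoidHom.mk' (fun f : Lp ℂ ∞ ν => star f) Lp.star_add_top) 1 fun f => by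
      rw [one_mul]
      refine Lp.norm_le_of_ae_bound_top (norm_nonneg _) ?_
      filter_upwards [Lp.coeFn_star f, Lp.ae_norm_le_norm_top f] with s h1 h2
      rw [AddMonoidHom.mk'_apply, h1, Pi.star_apply, norm_star]
      exact h2

namespace IsPOVM

variable {S : Type*} [MeasurableSpace S] {ν : Measure S}
  {K : Type*} [NormedAddCommGroup K] [InnerProductSpace ℂ K] [CompleteSpace K]
  {P : Set S → K →L[ℂ] K}

section Projections

variable (hP : IsPOVM ν P)
include hP

theorem le_one {Δ : Set S} (hΔ : MeasurableSet Δ) : P Δ ≤ 1 := by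
  rw [← hP.univ, ← Set.union_compl_self Δ, hP.union Δ Δᶜ hΔ hΔ.compl disjoint_compl_right]
  exact le_add_of_nonneg_right (hP.nonneg _ hΔ.compl)

theorem isStarProjection {Δ : Set S} (hΔ : MeasurableSet Δ) (h : P Δ * P Δ = P Δ) :
    IsStarProjection (P Δ) :=
  ⟨h, .of_nonneg (hP.nonneg Δ hΔ)⟩

/-- `P Δ + P Δ' = P (Δ ∪ Δ') ≤ 1` gives `P Δ ≤ 1 - P Δ'`, whose right-hand side is a projection. -/
theorem mul_eq_zero_of_disjoint (hmul : ∀ Δ, MeasurableSet Δ → P Δ * P Δ = P Δ) {Δ Δ' : Set S}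
    (hΔ : MeasurableSet Δ) (hΔ' : MeasurableSet Δ') (hd : Disjoint Δ Δ') : P Δ * P Δ' = 0 := by
  have h1 := hP.le_one (hΔ.union hΔ')
  rw [hP.union Δ Δ' hΔ hΔ' hd] at h1
  simpa using mul_eq_zero_of_le_of_isStarProjection (hP.nonneg Δ hΔ) (le_sub_iff_add_le.mpr h1)
    (hP.isStarProjection hΔ' (hmul Δ' hΔ')).one_sub

theorem inter_eq_mul (hmul : ∀ Δ, MeasurableSet Δ → P Δ * P Δ = P Δ) {Δ Δ' : Set S}
    (hΔ : MeasurableSet Δ) (hΔ' : MeasurableSet Δ') : P (Δ ∩ Δ') = P Δ * P Δ' := by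
  have h1 := hP.union (Δ ∩ Δ') (Δ \ Δ') (hΔ.inter hΔ') (hΔ.diff hΔ')
    (Set.disjoint_sdiff_right.mono_left Set.inter_subset_right)
  have h2 := hP.union (Δ ∩ Δ') (Δ' \ Δ) (hΔ.inter hΔ') (hΔ'.diff hΔ)
    (Set.disjoint_sdiff_right.mono_left Set.inter_subset_left)
  rw [Set.inter_union_sdiff] at h1
  rw [Set.inter_comm Δ Δ', Set.inter_union_sdiff, Set.inter_comm Δ' Δ] at h2
  rw [h1, h2, add_mul, mul_add, mul_add, hmul _ (hΔ.inter hΔ'),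
    hP.mul_eq_zero_of_disjoint hmul (hΔ.inter hΔ') (hΔ'.diff hΔ)
      (Set.disjoint_sdiff_right.mono_left Set.inter_subset_left),
    hP.mul_eq_zero_of_disjoint hmul (hΔ.diff hΔ') (hΔ.inter hΔ')
      (Set.disjoint_sdiff_left.mono_right Set.inter_subset_right),
    hP.mul_eq_zero_of_disjoint hmul (hΔ.diff hΔ') (hΔ'.diff hΔ)
      (Set.disjoint_sdiff_left.mono_right Set.sdiff_subset)]
  simp

end Projections

variable [IsFiniteMeasure ν] {κ : Lp ℂ ∞ ν →L[ℂ] (K →L[ℂ] K)}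

section Integral

variable (hκ : ∀ (Δ : Set S) (hΔ : MeasurableSet Δ) (c : ℂ),
    κ (indicatorConstLp ∞ hΔ (measure_ne_top ν Δ) c) = c • P Δ)
include hκ

theorem map_star (hP : IsPOVM ν P) (f : Lp ℂ ∞ ν) : κ (star f) = star (κ f) := by
  refine Lp.induction_top (p := fun f => κ (star f) = star (κ f))
    (isClosed_eq (κ.continuous.comp Lp.continuous_star_top) κ.continuous.star)
    (fun f g hf hg => by rw [Lp.star_add_top, map_add, map_add, star_add, hf, hg]) (fun Δ hΔ c => ?_) f
  rw [Lp.star_indicatorConstLp_top, hκ, hκ, star_smul,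
    (IsSelfAdjoint.of_nonneg (hP.nonneg Δ hΔ)).star_eq]

theorem map_smul_eq_mul (hmul : ∀ Δ Δ', MeasurableSet Δ → MeasurableSet Δ' →
    P (Δ ∩ Δ') = P Δ * P Δ') (f g : Lp ℂ ∞ ν) : κ (f • g : Lp ℂ ∞ ν) = κ f * κ g := by
  refine Lp.induction_top (p := fun g => κ (f • g : Lp ℂ ∞ ν) = κ f * κ g)
    (isClosed_eq (κ.continuous.comp (Lp.continuous_smul_right_top f))
      (continuous_const.mul κ.continuous))
    (fun g g' hg hg' => by rw [Lp.add_smul, map_add, map_add, mul_add, hg, hg'])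
    (fun Δ' hΔ' c' => ?_) g
  -- Commutativity moves `f` to the right factor, where continuity is available, for the second
  -- induction.
  rw [Lp.smul_comm_top]
  refine Lp.induction_top (p := fun f => κ (indicatorConstLp ∞ hΔ' (measure_ne_top ν Δ') c' • f :
      Lp ℂ ∞ ν) = κ f * κ (indicatorConstLp ∞ hΔ' (measure_ne_top ν Δ') c'))
    (isClosed_eq (κ.continuous.comp (Lp.continuous_smul_right_top _))
      (κ.continuous.mul continuous_const))
    (fun f f' hf hf' => by rw [Lp.add_smul, map_add, map_add, add_mul, hf, hf'])
    (fun Δ hΔ c => ?_) f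
  rw [Lp.smul_comm_top, Lp.indicatorConstLp_smul_top, hκ, hκ, hκ, hmul Δ Δ' hΔ hΔ',
    smul_mul_smul_comm]

theorem commute_integral {B : K →L[ℂ] K} (hB : ∀ Δ, MeasurableSet Δ → B * P Δ = P Δ * B)
    (f : Lp ℂ ∞ ν) : B * κ f = κ f * B := by
  refine Lp.induction_top (p := fun f => B * κ f = κ f * B)
    (isClosed_eq (continuous_const.mul κ.continuous) (κ.continuous.mul continuous_const))
    (fun f g hf hg => by rw [map_add, mul_add, add_mul, hf, hg]) (fun Δ hΔ c => ?_) f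
  rw [hκ, mul_smul_comm, smul_mul_assoc, hB Δ hΔ]

theorem isIdempotentElem_of_map_smul (hmul : ∀ f g : Lp ℂ ∞ ν, κ (f • g : Lp ℂ ∞ ν) = κ f * κ g)
    {Δ : Set S} (hΔ : MeasurableSet Δ) : P Δ * P Δ = P Δ := by
  have h := hmul (indicatorConstLp ∞ hΔ (measure_ne_top ν Δ) 1)
    (indicatorConstLp ∞ hΔ (measure_ne_top ν Δ) 1)
  rw [Lp.indicatorConstLp_smul_top, hκ, hκ] at h
  simpa using h.symm

/-- If `g ≠ 0`, then `h g = 1_Δ` for some `h` and some non-null `Δ`, and `P Δ k = κ h (κ g k) = 0`.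
-/
theorem eq_zero_of_apply_eq_zero
    (hmul : ∀ f g : Lp ℂ ∞ ν, κ (f • g : Lp ℂ ∞ ν) = κ f * κ g) {k : K}
    (hk : ∀ Δ, MeasurableSet Δ → P Δ k = 0 → ν Δ = 0) {g : Lp ℂ ∞ ν} (hg : κ g k = 0) : g = 0 := by
  by_contra hne
  obtain ⟨Δ, hΔ, h0, h, hh⟩ := Lp.exists_smul_eq_indicatorConstLp hne
  refine h0 (hk Δ hΔ ?_)
  have h1 := hmul h g
  rw [hh, hκ, one_smul] at h1
  rw [h1, mul_apply_eq_comp, hg, map_zero]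

theorem injective_of_map_smul
    (hmul : ∀ f g : Lp ℂ ∞ ν, κ (f • g : Lp ℂ ∞ ν) = κ f * κ g)
    (h0 : ∀ Δ, MeasurableSet Δ → P Δ = 0 → ν Δ = 0) : Injective κ := by
  refine (injective_iff_map_eq_zero κ).mpr fun g hg => ?_
  by_contra hne
  obtain ⟨Δ, hΔ, hν, h, hh⟩ := Lp.exists_smul_eq_indicatorConstLp hne
  refine hν (h0 Δ hΔ ?_)
  have h1 := hmul h g
  rwa [hh, hκ, one_smul, hg, mul_zero] at h1

end Integral

end IsPOVM

end

/-! ### Normal functionals, the relative commutant and the derivative of a CP-measure -/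

section

section TraceClass

variable {H : Type*} [NormedAddCommGroup H] [InnerProductSpace ℂ H] [CompleteSpace H]

theorem summable_traceClassFunctional (ξ η : lp (fun _ : ℕ => H) 2) (A : H →L[ℂ] H) :
    Summable fun n => inner ℂ (ξ n) (A (η n)) := by
  have h : Summable fun n => ‖ξ n‖ * ‖η n‖ :=
    lp.summable_mul (by rw [Real.holderConjugate_iff]; norm_num) ξ η
  refine .of_norm_bounded (h.mul_left ‖A‖) fun n => ?_
  refine (norm_inner_le_norm _ _).trans ?_
  calc ‖ξ n‖ * ‖A (η n)‖ ≤ ‖ξ n‖ * (‖A‖ * ‖η n‖) := by gcongr; exact A.le_opNorm _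
    _ = _ := by ring

theorem norm_traceClassFunctional_le (ξ η : lp (fun _ : ℕ => H) 2) (A : H →L[ℂ] H) :
    ‖traceClassFunctional ξ η A‖ ≤ (∑' n, ‖ξ n‖ * ‖η n‖) * ‖A‖ := by
  have h : Summable fun n => ‖ξ n‖ * ‖η n‖ :=
    lp.summable_mul (by rw [Real.holderConjugate_iff]; norm_num) ξ η
  rw [mul_comm]
  refine tsum_of_norm_bounded (h.hasSum.mul_left ‖A‖) fun n => ?_
  refine (norm_inner_le_norm _ _).trans ?_
  calc ‖ξ n‖ * ‖A (η n)‖ ≤ ‖ξ n‖ * (‖A‖ * ‖η n‖) := by gcongr; exact A.le_opNorm _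
    _ = _ := by ring

/-- `traceClassFunctional ξ η` as a norm-continuous linear functional. -/
noncomputable def traceClassCLM (ξ η : lp (fun _ : ℕ => H) 2) : (H →L[ℂ] H) →L[ℂ] ℂ :=
  LinearMap.mkContinuous
    { toFun := traceClassFunctional ξ η
      map_add' := fun A B => by
        simp only [traceClassFunctional, add_apply, inner_add_right]
        exact (summable_traceClassFunctional ξ η A).tsum_add (summable_traceClassFunctional ξ η B)
      map_smul' := fun c A => by
        simp only [traceClassFunctional, smul_apply, inner_smul_right]
        exact tsum_mul_left }
    _ (norm_traceClassFunctional_le ξ η)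

theorem traceClassCLM_apply (ξ η : lp (fun _ : ℕ => H) 2) (A : H →L[ℂ] H) :
    traceClassCLM ξ η A = traceClassFunctional ξ η A := rfl

theorem traceClassFunctional_single (ξ η : H) (A : H →L[ℂ] H) :
    traceClassFunctional (lp.single 2 0 ξ) (lp.single 2 0 η) A = inner ℂ ξ (A η) := by
  rw [traceClassFunctional, tsum_eq_single 0 fun n hn => by
    rw [lp.single_apply_ne _ _ _ hn, inner_zero_left]]
  simp

theorem IsClosed.of_sigmaWeakTopology {s : Set (H →L[ℂ] H)} (hs : @IsClosed _ (sigmaWeakTopology H) s) :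
    IsClosed s := by
  refine hs.mono (continuous_iff_le_induced.mp ?_)
  exact continuous_pi fun p => (traceClassCLM p.1 p.2).continuous

theorem continuous_inner_sigmaWeakTopology (ξ η : H) :
    @Continuous _ ℂ (sigmaWeakTopology H) _ fun A : H →L[ℂ] H => inner ℂ ξ (A η) := by
  simp_rw [← traceClassFunctional_single]
  let q : lp (fun _ : ℕ => H) 2 × lp (fun _ : ℕ => H) 2 := (lp.single 2 0 ξ, lp.single 2 0 η)
  exact @Continuous.comp _ _ _ (sigmaWeakTopology H) _ _ _ _ (continuous_apply q)
    (@continuous_induced_dom _ _ (fun (A : H →L[ℂ] H) (p : lp (fun _ : ℕ => H) 2 × lp (fun _ : ℕ => H) 2) =>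
      traceClassFunctional p.1 p.2 A) _)

namespace VonNeumannAlgebra

variable (M : VonNeumannAlgebra H)

/-- The normal functional `a ↦ ⟪ξ, a η⟫`. -/
noncomputable def vectorFunctional (ξ η : H) : M.toStarSubalgebra →ₗ[ℂ] ℂ :=
  (traceClassCLM (lp.single 2 0 ξ) (lp.single 2 0 η)).toLinearMap ∘ₗ
    M.toStarSubalgebra.toSubalgebra.val.toLinearMap

theorem isNormal_vectorFunctional (ξ η : H) : M.IsNormal (M.vectorFunctional ξ η) :=
  ⟨_, _, fun _ => rfl⟩

theorem vectorFunctional_apply (ξ η : H) (a : M.toStarSubalgebra) :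
    M.vectorFunctional ξ η a = inner ℂ ξ ((a : H →L[ℂ] H) η) :=
  traceClassFunctional_single ξ η a

end VonNeumannAlgebra

end TraceClass

variable {X : Type*} [CStarAlgebra X] [PartialOrder X] [StarOrderedRing X]
  {H : Type*} [NormedAddCommGroup H] [InnerProductSpace ℂ H] [CompleteSpace H]
  {K : Type*} [NormedAddCommGroup K] [InnerProductSpace ℂ K] [CompleteSpace K]
  {M : VonNeumannAlgebra H} {S : Type*} [MeasurableSpace S]

namespace CPMeasure

variable (μ : CPMeasure X M S)

theorem scalarMeasure_apply {ρ : M.toStarSubalgebra →ₗ[ℂ] ℂ} (hρ : M.IsNormal ρ) (x : X) {Δ : Set S}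
    (hΔ : MeasurableSet Δ) : μ.scalarMeasure hρ x Δ = ρ (μ Δ x) := if_pos hΔ

theorem union {Δ Δ' : Set S} (hΔ : MeasurableSet Δ) (hΔ' : MeasurableSet Δ') (hd : Disjoint Δ Δ')
    (x : X) : μ (Δ ∪ Δ') x = μ Δ x + μ Δ' x := by
  refine Subtype.ext (ContinuousLinearMap.ext fun η => ext_inner_left ℂ fun ξ => ?_)
  have h := VectorMeasure.of_union (v := μ.scalarMeasure (M.isNormal_vectorFunctional ξ η) x)
    hd hΔ hΔ'
  rw [scalarMeasure_apply _ _ _ hΔ, scalarMeasure_apply _ _ _ hΔ',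
    scalarMeasure_apply _ _ _ (hΔ.union hΔ'), ← map_add] at h
  simpa only [M.vectorFunctional_apply] using h

theorem le_univ {Δ : Set S} (hΔ : MeasurableSet Δ) : μ Δ ≤ μ Set.univ := by
  refine ⟨μ Δᶜ, fun x => ?_⟩
  rw [← Set.union_compl_self Δ, μ.union hΔ hΔ.compl disjoint_compl_right, add_sub_cancel_left]

end CPMeasure

namespace MinimalStinespring

variable {T : CPMap X M} (D : MinimalStinespring K T)

/-- Commutation with `π(x)` is an equality of matrix coefficients, hence a `σ`-weakly closed
condition, and it holds on the span. -/
theorem relCommutant_subset_commute {R : K →L[ℂ] K} (hR : R ∈ D.relCommutant) (x : X) :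
    R * D.π x = D.π x * R := by
  have hcl : @IsClosed _ (sigmaWeakTopology K) {A : K →L[ℂ] K | ∀ k l,
      inner ℂ k (A (D.π x l)) = inner ℂ (D.π (star x) k) (A l)} := by
    simp only [Set.ofPred_forall]
    refine @isClosed_iInter _ _ (sigmaWeakTopology K) _ fun k =>
      @isClosed_iInter _ _ (sigmaWeakTopology K) _ fun l =>
      @isClosed_eq _ _ _ (sigmaWeakTopology K) _ _ _ (continuous_inner_sigmaWeakTopology _ _)
        (continuous_inner_sigmaWeakTopology _ _)
  have h : R ∈ {A : K →L[ℂ] K | ∀ k l,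
      inner ℂ k (A (D.π x l)) = inner ℂ (D.π (star x) k) (A l)} := by
    refine @closure_minimal _ (sigmaWeakTopology K) _ _ ?_ hcl _ hR
    have : (Submodule.span ℂ {R : K →L[ℂ] K | R ∈ Set.centralizer (Set.range D.π) ∧ 0 ≤ R ∧ R ≤ 1 ∧
      ∃ T' : CPMap X M, ∀ x, (T' x : H →L[ℂ] H) = D.V.adjoint ∘L R ∘L D.π x ∘L D.V}) ≤
      (Subalgebra.centralizer ℂ (Set.range D.π)).toSubmodule :=
      Submodule.span_le.mpr fun A hA => hA.1
    intro A hA k l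
    have hA' : D.π x * A = A * D.π x := this hA (D.π x) ⟨x, rfl⟩
    rw [inner_π_left, star_star, ← mul_apply_eq_comp, ← hA', mul_apply_eq_comp]
  refine ContinuousLinearMap.ext fun l => ext_inner_left ℂ fun k => ?_
  rw [mul_apply_eq_comp, mul_apply_eq_comp, h k l, inner_π_left, star_star]

theorem isClosed_relCommutant : IsClosed D.relCommutant :=
  IsClosed.of_sigmaWeakTopology (@isClosed_closure _ (sigmaWeakTopology K) _)

/-- The map `R ↦ V* R π(x) V`. -/
noncomputable def compressCLM (x : X) : (K →L[ℂ] K) →L[ℂ] (H →L[ℂ] H) :=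
  (ContinuousLinearMap.compL ℂ H K H D.V.adjoint) ∘L
    (ContinuousLinearMap.compL ℂ H K K).flip (D.π x ∘L D.V)

theorem compressCLM_apply (x : X) (R : K →L[ℂ] K) : D.compressCLM x R = D.compress R x := rfl

theorem apply_V_eq_zero {R : K →L[ℂ] K} (hR : 0 ≤ R) (h : D.compress R 1 = 0) (ξ : H) :
    R (D.V ξ) = 0 := by
  obtain ⟨B, rfl⟩ := CStarAlgebra.exists_eq_star_mul_self hR
  have h1 := D.inner_compress (star B * B) 1 ξ ξ
  rw [h, map_one, zero_apply, inner_zero_right, one_apply_eq_self,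
    mul_apply_eq_comp, ContinuousLinearMap.star_eq_adjoint, ContinuousLinearMap.adjoint_inner_right,
    eq_comm, inner_self_eq_zero] at h1
  rw [mul_apply_eq_comp, h1, map_zero]

/-- Positivity gives `R V = 0`, and then `R π(x) V = π(x) R V = 0`. This is why the values `μ(Δ) 1`
alone detect the null sets of the derivative. -/
theorem eq_zero_of_compress_one_eq_zero {R : K →L[ℂ] K} (hR : 0 ≤ R)
    (hRπ : ∀ x, R * D.π x = D.π x * R) (h : D.compress R 1 = 0) : R = 0 := by
  refine D.ext_of_inner fun x y ξ η => ?_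
  rw [← mul_apply_eq_comp, hRπ, mul_apply_eq_comp, D.apply_V_eq_zero hR h, map_zero,
    zero_apply]

/-- `P Δ` is the Radon-Nikodym derivative of `μ Δ` with respect to `T`. -/
structure IsDerivative (μ : CPMeasure X M S) (P : Set S → K →L[ℂ] K) : Prop where
  nonneg : ∀ Δ, MeasurableSet Δ → 0 ≤ P Δ
  commute : ∀ Δ, MeasurableSet Δ → ∀ x, P Δ * D.π x = D.π x * P Δ
  compress_eq : ∀ Δ, MeasurableSet Δ → ∀ x, D.compress (P Δ) x = μ Δ x

variable {μ : CPMeasure X M S}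

theorem exists_isDerivative (hμ : μ Set.univ = T) : ∃ P, D.IsDerivative μ P := by
  have h : ∀ Δ : Set S, ∃ R : K →L[ℂ] K, MeasurableSet Δ → 0 ≤ R ∧ R ≤ 1 ∧
      (∀ x, R * D.π x = D.π x * R) ∧ ∀ x, D.compress R x = μ Δ x := fun Δ => by
    by_cases hΔ : MeasurableSet Δ
    · obtain ⟨R, hR⟩ := D.exists_radonNikodym (hμ ▸ μ.le_univ hΔ)
      exact ⟨R, fun _ => hR⟩
    -- A default value: `P` is only used on measurable sets.
    · exact ⟨0, fun h => absurd h hΔ⟩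
  choose P hP using h
  exact ⟨P, fun Δ hΔ => (hP Δ hΔ).1, fun Δ hΔ => (hP Δ hΔ).2.2.1, fun Δ hΔ => (hP Δ hΔ).2.2.2⟩

namespace IsDerivative

variable {D} {P : Set S → K →L[ℂ] K} (hD : D.IsDerivative μ P)
include hD

theorem eq_zero_iff {ρ : M.toStarSubalgebra →ₗ[ℂ] ℂ} (hρ : M.IsNormalFaithfulState ρ) {Δ : Set S}
    (hΔ : MeasurableSet Δ) : P Δ = 0 ↔ ρ (μ Δ 1) = 0 := by
  constructor
  · intro h
    have h1 : μ Δ 1 = 0 := Subtype.ext (by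
      rw [← hD.compress_eq Δ hΔ, h, ← D.compressCLM_apply, map_zero]; rfl)
    rw [h1, map_zero]
  · intro h
    have h1 : μ Δ 1 = 0 := hρ.faithful _ (by
      have := map_nonneg (μ Δ).toCompletelyPositiveMap (zero_le_one' X)
      exact this) h
    refine D.eq_zero_of_compress_one_eq_zero (hD.nonneg Δ hΔ) (hD.commute Δ hΔ) ?_
    rw [hD.compress_eq Δ hΔ, h1]; rfl

theorem isPOVM (hμ : μ Set.univ = T) {ρ : M.toStarSubalgebra →ₗ[ℂ] ℂ}
    (hρ : M.IsNormalFaithfulState ρ) {ν : Measure S} (hν : μ.IsEquivalentTo ρ ν) :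
    IsPOVM ν P where
  nonneg := hD.nonneg
  union Δ Δ' hΔ hΔ' hd := by
    refine D.eq_of_compress_eq (hD.commute _ (hΔ.union hΔ')) (fun x => ?_) fun x => ?_
    · rw [add_mul, mul_add, hD.commute Δ hΔ, hD.commute Δ' hΔ']
    · rw [compress_add, hD.compress_eq _ (hΔ.union hΔ'), hD.compress_eq _ hΔ,
        hD.compress_eq _ hΔ', μ.union hΔ hΔ' hd]
      rfl
  univ := D.eq_of_compress_eq (hD.commute _ .univ) (fun x => by rw [one_mul, mul_one]) fun x => by
    rw [hD.compress_eq _ .univ, hμ, compress_one]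
  null Δ hΔ h := (hD.eq_zero_iff hρ hΔ).mpr ((hν Δ hΔ).mp h)

theorem mem_relCommutant {Δ : Set S} (hΔ : MeasurableSet Δ) (h1 : P Δ ≤ 1) (c : ℂ) :
    c • P Δ ∈ Submodule.span ℂ {R : K →L[ℂ] K | R ∈ Set.centralizer (Set.range D.π) ∧ 0 ≤ R ∧
      R ≤ 1 ∧ ∃ T' : CPMap X M, ∀ x,
        (T' x : H →L[ℂ] H) = D.V.adjoint ∘L R ∘L D.π x ∘L D.V} := by
  refine Submodule.smul_mem _ _ (Submodule.subset_span ⟨?_, hD.nonneg Δ hΔ, h1, μ Δ, fun x => ?_⟩)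
  · rintro _ ⟨x, rfl⟩
    exact (hD.commute Δ hΔ x).symm
  · exact (hD.compress_eq Δ hΔ x).symm

theorem isKappa {ν : Measure S} [IsFiniteMeasure ν] (hP : IsPOVM ν P)
    {κ : Lp ℂ ∞ ν →L[ℂ] (K →L[ℂ] K)}
    (hκ : ∀ (Δ : Set S) (hΔ : MeasurableSet Δ) (c : ℂ),
      κ (indicatorConstLp ∞ hΔ (measure_ne_top ν Δ) c) = c • P Δ) :
    μ.IsKappa D ν κ.toLinearMap where
  mem_relCommutant f := by
    -- Integrals of simple functions lie in the span itself, and a `σ`-weakly closed set is norm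
    -- closed.
    refine SimpleFunc.denseRange_toLinfty.induction_on (p := fun f => κ f ∈ D.relCommutant) f
      (D.isClosed_relCommutant.preimage κ.continuous) fun f => ?_
    refine @subset_closure _ (sigmaWeakTopology K) _ _ ?_
    rw [SimpleFunc.toLinfty_eq_sum, map_sum]
    refine sum_mem fun c _ => ?_
    rw [hκ]
    exact hD.mem_relCommutant (f.measurableSet_fiber c) (hP.le_one (f.measurableSet_fiber c)) c
  integral_eq f x := by
    have hm : ∀ f, D.compressCLM x (κ f) ∈ M := fun f => by
      refine Lp.induction_top (p := fun f => D.compressCLM x (κ f) ∈ M)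
        (M.isClosed.preimage ((D.compressCLM x).continuous.comp κ.continuous))
        (fun f g hf hg => by rw [map_add, map_add]; exact add_mem hf hg) (fun Δ hΔ c => ?_) f
      rw [hκ, map_smul, compressCLM_apply, hD.compress_eq Δ hΔ]
      exact M.toStarSubalgebra.smul_mem (μ Δ x).2 c
    refine ⟨⟨D.compressCLM x (κ f), hm f⟩, rfl, fun ρ hρ => ?_⟩
    obtain ⟨ξ, η, h⟩ := id hρ
    rw [h]
    refine ComplexMeasure.eq_integral_of_indicator (fun Δ hΔ h0 => ?_)
      (traceClassCLM ξ η ∘L D.compressCLM x ∘L κ) (fun Δ hΔ c => ?_) f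
    · rw [μ.scalarMeasure_apply hρ x hΔ, h, ← hD.compress_eq Δ hΔ, hP.null Δ hΔ h0,
        ← D.compressCLM_apply, map_zero, ← traceClassCLM_apply, map_zero]
    · rw [μ.scalarMeasure_apply hρ x hΔ, h, ← hD.compress_eq Δ hΔ, ContinuousLinearMap.comp_apply,
        ContinuousLinearMap.comp_apply, hκ, map_smul, map_smul, smul_eq_mul]
      rfl

end IsDerivative

/-- Both values lie in the commutant, and the vector functionals, being normal, recover their
compressions from the integrals. -/
theorem kappa_unique {ν : Measure S} {κ κ' : Lp ℂ ∞ ν →ₗ[ℂ] (K →L[ℂ] K)}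
    (hκ : μ.IsKappa D ν κ) (hκ' : μ.IsKappa D ν κ') : κ' = κ := by
  refine LinearMap.ext fun f => D.eq_of_compress_eq
    (D.relCommutant_subset_commute (hκ'.mem_relCommutant f))
    (D.relCommutant_subset_commute (hκ.mem_relCommutant f)) fun x => ?_
  obtain ⟨a, ha, hρ⟩ := hκ.integral_eq f x
  obtain ⟨a', ha', hρ'⟩ := hκ'.integral_eq f x
  rw [compress, compress, ← ha, ← ha']
  refine ContinuousLinearMap.ext fun η => ext_inner_left ℂ fun ξ => ?_
  rw [← M.vectorFunctional_apply, ← M.vectorFunctional_apply,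
    hρ _ (M.isNormal_vectorFunctional ξ η), hρ' _ (M.isNormal_vectorFunctional ξ η)]

theorem IsDerivative.isOrthogonalOf_iff {D : MinimalStinespring K T} {P : Set S → K →L[ℂ] K}
    (hD : D.IsDerivative μ P) {ν : Measure S}
    (hP : IsPOVM ν P) (hμ : μ Set.univ = T) :
    μ.IsOrthogonalOf T ↔ ∀ Δ, MeasurableSet Δ → P Δ * P Δ = P Δ := by
  have hc : ∀ Δ, MeasurableSet Δ → ∀ x, D.compress (1 - P Δ) x = μ Δᶜ x := fun Δ hΔ x => by
    rw [← hD.compress_eq Δᶜ hΔ.compl, ← hP.univ, ← Set.union_compl_self Δ,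
      hP.union _ _ hΔ hΔ.compl disjoint_compl_right, add_sub_cancel_left]
  constructor
  · intro h Δ hΔ
    exact D.mul_self_of_orthogonal (hD.nonneg Δ hΔ) (hP.le_one hΔ) (hD.commute Δ hΔ)
      (hD.compress_eq Δ hΔ) (hc Δ hΔ) (h.2 Δ hΔ)
  · intro h
    exact ⟨hμ, fun Δ hΔ => D.orthogonal_of_mul_self (hP.isStarProjection hΔ (h Δ hΔ))
      (hD.commute Δ hΔ) (hD.compress_eq Δ hΔ) (hc Δ hΔ)⟩

end MinimalStinespring

end

/-! ### Scalar spectral measures and a separating vector -/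

section

namespace IsPOVM

variable {S : Type*} [MeasurableSpace S] {ν : Measure S}
  {K : Type*} [NormedAddCommGroup K] [InnerProductSpace ℂ K] [CompleteSpace K]
  {P : Set S → K →L[ℂ] K}

/-- Strong `σ`-additivity of an operator valued set function. -/
def _root_.IsStronglySigmaAdditive (P : Set S → K →L[ℂ] K) : Prop :=
  ∀ Δ : ℕ → Set S, (∀ i, MeasurableSet (Δ i)) → Pairwise (Disjoint on Δ) → ∀ k : K,
    Filter.Tendsto (fun n => ∑ i ∈ Finset.range n, P (Δ i) k) Filter.atTop (nhds (P (⋃ i, Δ i) k))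

theorem exists_measure (hP : IsPOVM ν P) (hσ : IsStronglySigmaAdditive P) (k l : K)
    (h : ∀ Δ, MeasurableSet Δ → 0 ≤ (inner ℂ k (P Δ l)).re) :
    ∃ m : Measure S, ∀ Δ, MeasurableSet Δ → m Δ = ENNReal.ofReal (inner ℂ k (P Δ l)).re := by
  refine ⟨Measure.ofMeasurable (fun Δ _ => ENNReal.ofReal (inner ℂ k (P Δ l)).re) ?_ ?_,
    fun Δ hΔ => Measure.ofMeasurable_apply Δ hΔ⟩
  · simp [hP.empty]
  · intro Δ hΔ hd
    have hs : HasSum (fun i => (inner ℂ k (P (Δ i) l)).re) (inner ℂ k (P (⋃ i, Δ i) l)).re := by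
      rw [hasSum_iff_tendsto_nat_of_nonneg fun i => h _ (hΔ i)]
      have h1 := (Complex.continuous_re.comp (innerSL ℂ k).continuous).continuousAt.tendsto.comp
        (hσ Δ hΔ hd l)
      refine h1.congr fun n => ?_
      simp [inner_sum]
    rw [← hs.tsum_eq, ENNReal.ofReal_tsum_of_nonneg (fun i => h _ (hΔ i)) hs.summable]

theorem inner_apply_self (hP : IsPOVM ν P) (hmul : ∀ Δ, MeasurableSet Δ → P Δ * P Δ = P Δ)
    {Δ : Set S} (hΔ : MeasurableSet Δ) (k l : K) :
    inner ℂ k (P Δ l) = inner ℂ (P Δ k) (P Δ l) := by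
  have h : (P Δ).adjoint = P Δ := (IsSelfAdjoint.of_nonneg (hP.nonneg Δ hΔ)).star_eq
  rw [← ContinuousLinearMap.adjoint_inner_right, h, ← mul_apply_eq_comp, hmul Δ hΔ]

theorem exists_spectral_measure (hP : IsPOVM ν P) (hσ : IsStronglySigmaAdditive P)
    (hmul : ∀ Δ, MeasurableSet Δ → P Δ * P Δ = P Δ) (w : K) :
    ∃ m : Measure S, IsFiniteMeasure m ∧ m ≪ ν ∧
      ∀ Δ, MeasurableSet Δ → m Δ = ENNReal.ofReal (‖P Δ w‖ ^ 2) := by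
  have h : ∀ Δ, MeasurableSet Δ → (inner ℂ w (P Δ w)).re = ‖P Δ w‖ ^ 2 := fun Δ hΔ => by
    rw [hP.inner_apply_self hmul hΔ, ← ofReal_norm_sq_eq_inner, Complex.ofReal_re]
  obtain ⟨m, hm⟩ := hP.exists_measure hσ w w fun Δ hΔ => h Δ hΔ ▸ sq_nonneg _
  refine ⟨m, ⟨?_⟩, Measure.AbsolutelyContinuous.mk fun Δ hΔ h0 => ?_, fun Δ hΔ => ?_⟩
  · rw [hm _ .univ]; exact ENNReal.ofReal_lt_top
  · rw [hm Δ hΔ, hP.null Δ hΔ h0]; simp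
  · rw [hm Δ hΔ, h Δ hΔ]

theorem norm_apply_le (hP : IsPOVM ν P)
    (hmul : ∀ Δ, MeasurableSet Δ → P Δ * P Δ = P Δ) {Δ : Set S} (hΔ : MeasurableSet Δ) (k : K) :
    ‖P Δ k‖ ≤ ‖k‖ := by
  have h := hP.inner_apply_self hmul hΔ k k
  rw [← ofReal_norm_sq_eq_inner] at h
  have h1 : ‖P Δ k‖ ^ 2 ≤ ‖k‖ * ‖P Δ k‖ := by
    refine le_trans (le_of_eq ?_) (norm_inner_le_norm (𝕜 := ℂ) k (P Δ k))
    rw [h, Complex.norm_real, Real.norm_of_nonneg (sq_nonneg _)]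
  by_contra! hlt
  nlinarith [norm_nonneg k]

/-- A sequence of vectors that separates the values of `P` can be replaced by a single vector. -/
theorem exists_separating [IsFiniteMeasure ν] (hP : IsPOVM ν P) (hσ : IsStronglySigmaAdditive P)
    (hmul : ∀ Δ, MeasurableSet Δ → P Δ * P Δ = P Δ) (v : ℕ → K)
    (hv : ∀ Δ, MeasurableSet Δ → (∀ n, P Δ (v n) = 0) → ν Δ = 0) :
    ∃ k, ∀ Δ, MeasurableSet Δ → P Δ k = 0 → ν Δ = 0 := by
  choose m hfin hac hm using fun n => hP.exists_spectral_measure hσ hmul (v n)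
  have hm0 : ∀ n Δ, MeasurableSet Δ → (m n Δ = 0 ↔ P Δ (v n) = 0) := fun n Δ hΔ => by
    rw [hm n Δ hΔ]
    simp
  -- `A n` carries the spectral measure `m n` of `v n`: on `A n` the measures `m n` and `ν` have the
  -- same null sets.
  let A : ℕ → Set S := fun n => {s | (m n).rnDeriv ν s ≠ 0}
  have hA : ∀ n, MeasurableSet (A n) := fun n =>
    (Measure.measurable_rnDeriv _ _ (measurableSet_singleton 0)).compl
  have hmA : ∀ n Δ, m n Δ = 0 ↔ ν (A n ∩ Δ) = 0 := fun n Δ => by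
    conv_lhs => rw [← Measure.withDensity_rnDeriv_eq _ _ (hac n)]
    exact withDensity_apply_eq_zero (Measure.measurable_rnDeriv _ _)
  let B : ℕ → Set S := disjointed A
  have hB : ∀ n, MeasurableSet (B n) := fun n => MeasurableSet.disjointed hA n
  have hBd : Pairwise (Disjoint on B) := disjoint_disjointed A
  -- The weights make the series converge: `c n * (1 + ‖v n‖) = 2⁻ⁿ`.
  let c : ℕ → ℝ := fun n => (1 / 2) ^ n / (1 + ‖v n‖)
  have hc : ∀ n, c n ≠ 0 := fun n => by positivity
  have hsum : Summable fun n => (c n : ℂ) • P (B n) (v n) := by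
    refine .of_norm_bounded (summable_geometric_two) fun n => ?_
    rw [norm_smul, Complex.norm_real, Real.norm_of_nonneg (by positivity)]
    calc c n * ‖P (B n) (v n)‖ ≤ c n * (1 + ‖v n‖) := by
          gcongr
          linarith [hP.norm_apply_le hmul (hB n) (v n)]
      _ = (1 / 2) ^ n := div_mul_cancel₀ _ (by positivity)
  refine ⟨∑' n, (c n : ℂ) • P (B n) (v n), fun Δ hΔ h => ?_⟩
  -- The projection `P (B n)` isolates the `n`-th term of the series, so `P Δ k = 0` forces `P (Δ ∩
  -- B n) (v n) = 0`; as `B n ⊆ A n`, this is a statement about `ν`.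
  have h1 : ∀ n, ν (Δ ∩ B n) = 0 := fun n => by
    have h2 : P (Δ ∩ B n) (v n) = 0 := by
      have h3 : P (B n) (∑' n, (c n : ℂ) • P (B n) (v n)) = (c n : ℂ) • P (B n) (v n) := by
        rw [(P (B n)).map_tsum hsum, tsum_eq_single n fun j hj => ?_]
        · rw [map_smul, ← mul_apply_eq_comp, hmul _ (hB n)]
        · rw [map_smul, ← mul_apply_eq_comp, hP.mul_eq_zero_of_disjoint hmul (hB n) (hB j)
            (hBd hj.symm), zero_apply, smul_zero]
      have h4 : P Δ (P (B n) (∑' n, (c n : ℂ) • P (B n) (v n))) = 0 := by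
        rw [← mul_apply_eq_comp, ← hP.inter_eq_mul hmul hΔ (hB n), Set.inter_comm,
          hP.inter_eq_mul hmul (hB n) hΔ, mul_apply_eq_comp, h, map_zero]
      rw [h3, map_smul, smul_eq_zero, Complex.ofReal_eq_zero] at h4
      rw [hP.inter_eq_mul hmul hΔ (hB n), mul_apply_eq_comp]
      exact h4.resolve_left (hc n)
    rw [← hm0 n _ (hΔ.inter (hB n)), hmA] at h2
    refine measure_mono_null (Set.subset_inter
      (Set.inter_subset_right.trans (disjointed_subset A n)) subset_rfl) h2
  -- Off all the `A n` every spectral measure vanishes, and the `v n` separate jointly.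
  have h2 : ν (Δ \ ⋃ n, A n) = 0 := by
    refine hv _ (hΔ.diff (.iUnion hA)) fun n => ?_
    rw [← hm0 n _ (hΔ.diff (.iUnion hA)), hmA]
    refine measure_mono_null (fun s hs => ?_) (measure_empty (μ := ν))
    exact hs.2.2 (Set.mem_iUnion.mpr ⟨n, hs.1⟩)
  refine measure_mono_null (t := (Δ \ ⋃ n, A n) ∪ ⋃ n, Δ ∩ B n) (fun s hs => ?_)
    (measure_union_null h2 (measure_iUnion_null h1))
  rw [← Set.inter_iUnion, iUnion_disjointed]
  by_cases hsA : s ∈ ⋃ n, A n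
  · exact Or.inr ⟨hs, hsA⟩
  · exact Or.inl ⟨hs, hsA⟩

section Integral

variable [IsFiniteMeasure ν] {κ : Lp ℂ ∞ ν →L[ℂ] (K →L[ℂ] K)}
  (hκ : ∀ (Δ : Set S) (hΔ : MeasurableSet Δ) (c : ℂ),
    κ (indicatorConstLp ∞ hΔ (measure_ne_top ν Δ) c) = c • P Δ)
include hκ

theorem inner_integral (hP : IsPOVM ν P) (hmul : ∀ Δ, MeasurableSet Δ → P Δ * P Δ = P Δ) {w : K}
    {m : Measure S} [IsFiniteMeasure m] (hac : m ≪ ν)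
    (hm : ∀ Δ, MeasurableSet Δ → m Δ = ENNReal.ofReal (‖P Δ w‖ ^ 2)) (f : Lp ℂ ∞ ν) :
    inner ℂ w (κ f w) = ∫ s, f s ∂m := by
  have hint : ∀ f : Lp ℂ ∞ ν, Integrable f m := fun f =>
    Integrable.of_bound ((Lp.aestronglyMeasurable f).mono_ac hac) ‖f‖
      (hac.ae_le (Lp.ae_norm_le_norm_top f))
  let I : Lp ℂ ∞ ν →+ ℂ := AddMonoidHom.mk' (fun f => ∫ s, f s ∂m) fun f g => by
    rw [← integral_add (hint f) (hint g)]
    exact integral_congr_ae (hac.ae_le (Lp.coeFn_add f g))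
  have hI : Continuous I := by
    refine AddMonoidHomClass.continuous_of_bound I (m.real Set.univ) fun f => ?_
    rw [mul_comm]
    exact norm_integral_le_of_norm_le_const (hac.ae_le (Lp.ae_norm_le_norm_top f))
  refine Lp.induction_top (p := fun f => inner ℂ w (κ f w) = I f)
    (isClosed_eq (by fun_prop) hI)
    (fun f g hf hg => by rw [map_add, map_add, add_apply, inner_add_right, hf, hg])
    (fun Δ hΔ c => ?_) f
  refine Eq.trans ?_ (integral_congr_ae (hac.ae_le indicatorConstLp_coeFn)).symm
  rw [integral_indicator_const c hΔ, hκ, smul_apply, inner_smul_right,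
    hP.inner_apply_self hmul hΔ, ← ofReal_norm_sq_eq_inner, measureReal_def, hm Δ hΔ,
    ENNReal.toReal_ofReal (sq_nonneg _), Complex.real_smul, mul_comm]

end Integral
end IsPOVM

end

/-! ### The bicommutant of a projection valued measure -/

section

namespace IsPOVM

variable {S : Type*} [MeasurableSpace S] {ν : Measure S}
  {K : Type*} [NormedAddCommGroup K] [InnerProductSpace ℂ K] [CompleteSpace K]
  {P : Set S → K →L[ℂ] K}

/-- The bicommutant of the values of `P`. -/
def _root_.IsInBicommutant (P : Set S → K →L[ℂ] K) (B : K →L[ℂ] K) : Prop :=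
  ∀ E : K →L[ℂ] K, (∀ Δ, MeasurableSet Δ → E * P Δ = P Δ * E) → E * B = B * E

/-- The projection onto the cyclic subspace generated by `w` commutes with `P`, hence with `B`, and
it fixes `w`. -/
theorem _root_.IsInBicommutant.apply_mem (hP : IsPOVM ν P)
    (hmul : ∀ Δ, MeasurableSet Δ → P Δ * P Δ = P Δ) {B : K →L[ℂ] K} (hB : IsInBicommutant P B)
    (w : K) :
    B w ∈ (Submodule.span ℂ {k | ∃ Δ, MeasurableSet Δ ∧ P Δ w = k}).topologicalClosure := by
  set L := (Submodule.span ℂ {k | ∃ Δ, MeasurableSet Δ ∧ P Δ w = k}).topologicalClosure with hL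
  have hLc : IsClosed (L : Set K) := Submodule.isClosed_topologicalClosure _
  have : CompleteSpace L := hLc.completeSpace_coe
  have hinv : ∀ Δ, MeasurableSet Δ → ∀ k ∈ L, P Δ k ∈ L := fun Δ hΔ => by
    have h : Submodule.span ℂ {k | ∃ Δ, MeasurableSet Δ ∧ P Δ w = k} ≤
        L.comap (P Δ).toLinearMap := by
      refine Submodule.span_le.mpr ?_
      rintro _ ⟨Δ', hΔ', rfl⟩
      refine Submodule.le_topologicalClosure _ (Submodule.subset_span ⟨Δ ∩ Δ', hΔ.inter hΔ', ?_⟩)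
      rw [hP.inter_eq_mul hmul hΔ hΔ', mul_apply_eq_comp]
      rfl
    exact Submodule.topologicalClosure_minimal _ h (hLc.preimage (P Δ).continuous)
  have hinv' : ∀ Δ, MeasurableSet Δ → ∀ k ∈ Lᗮ, P Δ k ∈ Lᗮ := fun Δ hΔ k hk l hl => by
    have h : (P Δ).adjoint = P Δ := (IsSelfAdjoint.of_nonneg (hP.nonneg Δ hΔ)).star_eq
    rw [← h, ContinuousLinearMap.adjoint_inner_right]
    exact hk _ (hinv Δ hΔ l hl)
  have hE : ∀ Δ, MeasurableSet Δ → L.starProjection * P Δ = P Δ * L.starProjection :=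
    fun Δ hΔ => ContinuousLinearMap.ext fun k => by
      rw [mul_apply_eq_comp, mul_apply_eq_comp]
      refine Submodule.eq_starProjection_of_mem_of_inner_eq_zero
        (hinv Δ hΔ _ (Submodule.starProjection_apply_mem _ _)) (fun l hl => ?_)
      rw [← map_sub]
      have h := hinv' Δ hΔ _ (L.sub_starProjection_mem_orthogonal k)
      exact inner_eq_zero_symm.mp (h l hl)
  have hw : w ∈ L := Submodule.le_topologicalClosure _ (Submodule.subset_span
    ⟨Set.univ, .univ, by rw [hP.univ]; rfl⟩)
  have h := congrArg (· w) (hB _ hE)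
  simp only [mul_apply_eq_comp] at h
  rw [Submodule.starProjection_eq_self_iff.mpr hw] at h
  rw [← h]
  exact Submodule.starProjection_apply_mem _ _

section Integral

variable [IsFiniteMeasure ν] {κ : Lp ℂ ∞ ν →L[ℂ] (K →L[ℂ] K)}
  (hκ : ∀ (Δ : Set S) (hΔ : MeasurableSet Δ) (c : ℂ),
    κ (indicatorConstLp ∞ hΔ (measure_ne_top ν Δ) c) = c • P Δ)
include hκ

theorem isInBicommutant_integral (f : Lp ℂ ∞ ν) : IsInBicommutant P (κ f) :=
  fun _ hE => commute_integral hκ hE f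

/-- The measure `⟪w, P(Δ) B w⟫ = ⟪P(Δ) w, B P(Δ) w⟫` is at most `c ‖P(Δ) w‖²`. Its density `g` with
respect to the spectral measure of `w` satisfies `⟪P(Δ) w, (B - κ g) w⟫ = 0` for all `Δ`, while `(B
- κ g) w` lies in the closed span of the `P(Δ) w`. -/
theorem exists_integral_apply_of_nonneg (hP : IsPOVM ν P) (hσ : IsStronglySigmaAdditive P)
    (hmul : ∀ Δ, MeasurableSet Δ → P Δ * P Δ = P Δ) {B : K →L[ℂ] K} (hB : IsInBicommutant P B)
    (hB0 : 0 ≤ B) {c : ℝ} (hc : 0 ≤ c) (hB1 : B ≤ (c : ℂ) • 1) (w : K) : ∃ f, B w = κ f w := by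
  have hBP : ∀ Δ, MeasurableSet Δ → P Δ * B = B * P Δ := fun Δ hΔ => hB _ fun Δ' hΔ' => by
    rw [← hP.inter_eq_mul hmul hΔ hΔ', ← hP.inter_eq_mul hmul hΔ' hΔ, Set.inter_comm]
  have hBw : ∀ Δ, MeasurableSet Δ → inner ℂ w (P Δ (B w)) = inner ℂ (P Δ w) (B (P Δ w)) :=
    fun Δ hΔ => by
      rw [hP.inner_apply_self hmul hΔ, ← mul_apply_eq_comp, hBP Δ hΔ, mul_apply_eq_comp]
  have hpos : ∀ Δ, MeasurableSet Δ → 0 ≤ inner ℂ w (P Δ (B w)) := fun Δ hΔ => by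
    rw [hBw Δ hΔ]
    exact (ContinuousLinearMap.nonneg_iff_isPositive _).mp hB0 |>.inner_nonneg_right _
  have hle : ∀ Δ, MeasurableSet Δ → (inner ℂ w (P Δ (B w))).re ≤ c * ‖P Δ w‖ ^ 2 :=
    fun Δ hΔ => by
      have h := ((ContinuousLinearMap.le_def _ _).mp hB1).inner_nonneg_right (P Δ w)
      rw [sub_apply, smul_apply, one_apply_eq_self, inner_sub_right, inner_smul_right,
        ← ofReal_norm_sq_eq_inner, ← hBw Δ hΔ] at h
      have h2 := (Complex.le_def.mp h).1
      rw [Complex.sub_re, ← Complex.ofReal_mul, Complex.ofReal_re] at h2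
      simpa using h2
  obtain ⟨m, hm⟩ := hP.exists_measure hσ w (B w) fun Δ hΔ => (Complex.le_def.mp (hpos Δ hΔ)).1
  obtain ⟨mw, hfin, hac, hmw⟩ := hP.exists_spectral_measure hσ hmul w
  have hmle : ∀ Δ, MeasurableSet Δ → m Δ ≤ ENNReal.ofReal c * mw Δ := fun Δ hΔ => by
    rw [hm Δ hΔ, hmw Δ hΔ, ← ENNReal.ofReal_mul hc]
    exact ENNReal.ofReal_le_ofReal (hle Δ hΔ)
  have hmfin : IsFiniteMeasure m := ⟨by rw [hm _ .univ]; exact ENNReal.ofReal_lt_top⟩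
  have hmac : m ≪ mw := Measure.AbsolutelyContinuous.mk fun Δ hΔ h0 =>
    le_antisymm ((hmle Δ hΔ).trans (by rw [h0, mul_zero])) zero_le
  have hg : m.rnDeriv mw ≤ᵐ[mw] fun _ => ENNReal.ofReal c := by
    refine ae_le_of_forall_setLIntegral_le_of_sigmaFinite (Measure.measurable_rnDeriv _ _)
      fun Δ hΔ _ => ?_
    rw [Measure.setLIntegral_rnDeriv hmac, setLIntegral_const]
    exact hmle Δ hΔ
  -- The density is at most `c` only almost everywhere for `mw`, which may have more null sets than
  -- `ν`; truncation bounds it everywhere.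
  let g : S → ℂ := fun s => ((min ((m.rnDeriv mw s).toReal) c : ℝ) : ℂ)
  have hgm : Measurable g := Complex.measurable_ofReal.comp
    ((Measure.measurable_rnDeriv _ _).ennreal_toReal.min measurable_const)
  have hgmem : MemLp g ∞ ν := memLp_top_of_bound hgm.aestronglyMeasurable c
    (Filter.Eventually.of_forall fun s => by
      rw [Complex.norm_real, Real.norm_of_nonneg (le_min ENNReal.toReal_nonneg hc)]
      exact min_le_right _ _)
  have hgint : ∀ Δ, MeasurableSet Δ → ∫ s in Δ, g s ∂mw = inner ℂ w (P Δ (B w)) := fun Δ hΔ => by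
    have h1 : ∫ s in Δ, g s ∂mw = ∫ s in Δ, ((m.rnDeriv mw s).toReal : ℂ) ∂mw := by
      refine integral_congr_ae (ae_restrict_of_ae ?_)
      filter_upwards [hg] with s hs
      have : (m.rnDeriv mw s).toReal ≤ c := ENNReal.toReal_le_of_le_ofReal hc hs
      simp only [g, min_eq_left this]
    have h2 : ∫ s in Δ, ((m.rnDeriv mw s).toReal : ℂ) ∂mw =
        ((∫ s in Δ, (m.rnDeriv mw s).toReal ∂mw : ℝ) : ℂ) := integral_ofReal
    rw [h1, h2, Measure.setIntegral_toReal_rnDeriv hmac, measureReal_def, hm Δ hΔ,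
      ENNReal.toReal_ofReal (Complex.le_def.mp (hpos Δ hΔ)).1]
    exact Complex.ext (by simp) (by simpa using (Complex.le_def.mp (hpos Δ hΔ)).2)
  have hmul' : ∀ Δ Δ', MeasurableSet Δ → MeasurableSet Δ' → P (Δ ∩ Δ') = P Δ * P Δ' :=
    fun Δ Δ' hΔ hΔ' => hP.inter_eq_mul hmul hΔ hΔ'
  refine ⟨hgmem.toLp, ?_⟩
  have key : ∀ Δ, MeasurableSet Δ → inner ℂ (P Δ w) ((B - κ hgmem.toLp) w) = 0 := fun Δ hΔ => by
    have h := hP.inner_integral hκ hmul hac hmw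
      (indicatorConstLp ∞ hΔ (measure_ne_top ν Δ) (1 : ℂ) • hgmem.toLp : Lp ℂ ∞ ν)
    have h1 : ∫ s, (indicatorConstLp ∞ hΔ (measure_ne_top ν Δ) (1 : ℂ) • hgmem.toLp : Lp ℂ ∞ ν) s ∂mw =
        ∫ s in Δ, g s ∂mw := by
      rw [← integral_indicator hΔ]
      refine integral_congr_ae (hac.ae_le ?_)
      filter_upwards [Lp.coeFn_lpSMul (r := ∞) (indicatorConstLp ∞ hΔ (measure_ne_top ν Δ) (1 : ℂ))
        hgmem.toLp, hgmem.coeFn_toLp, indicatorConstLp_coeFn (p := ∞) (hs := hΔ)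
        (hμs := measure_ne_top ν Δ) (c := (1 : ℂ))] with s h1 h2 h3
      rw [h1, Pi.smul_apply', h2, h3]
      by_cases hs : s ∈ Δ <;> simp [hs]
    rw [h1, hgint Δ hΔ, map_smul_eq_mul hκ hmul', hκ, one_smul, mul_apply_eq_comp] at h
    have hs : (P Δ).adjoint = P Δ := (IsSelfAdjoint.of_nonneg (hP.nonneg Δ hΔ)).star_eq
    rw [← hs, ContinuousLinearMap.adjoint_inner_left, sub_apply, map_sub, inner_sub_right, h,
      sub_self]
  have hC : IsInBicommutant P (B - κ hgmem.toLp) := fun E hE => by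
    rw [mul_sub, sub_mul, hB E hE, isInBicommutant_integral hκ _ E hE]
  have hmem := hC.apply_mem hP hmul w
  have h0 : ∀ k ∈ (Submodule.span ℂ {k | ∃ Δ, MeasurableSet Δ ∧ P Δ w = k}).topologicalClosure,
      inner ℂ k ((B - κ hgmem.toLp) w) = 0 := fun k hk => by
    refine closure_minimal (s := (Submodule.span ℂ {k | ∃ Δ, MeasurableSet Δ ∧ P Δ w = k} : Set K))
      (t := {k | inner ℂ k ((B - κ hgmem.toLp) w) = 0}) (fun k hk => ?_)
      (isClosed_eq (by fun_prop) continuous_const) hk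
    induction hk using Submodule.span_induction with
    | mem k hk => obtain ⟨Δ, hΔ, rfl⟩ := hk; exact key Δ hΔ
    | zero => exact inner_zero_left _
    | add k l _ _ hk hl => exact (inner_add_left _ _ _).trans (by rw [hk, hl, add_zero])
    | smul c k _ hk => exact (inner_smul_left _ _ _).trans (by rw [hk, mul_zero])
  have := inner_self_eq_zero.mp (h0 _ hmem)
  rwa [sub_apply, sub_eq_zero] at this

theorem exists_integral_apply (hP : IsPOVM ν P) (hσ : IsStronglySigmaAdditive P)
    (hmul : ∀ Δ, MeasurableSet Δ → P Δ * P Δ = P Δ) {B : K →L[ℂ] K} (hB : IsInBicommutant P B)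
    (w : K) : ∃ f, B w = κ f w := by
  have h1 : ∀ A : K →L[ℂ] K, IsInBicommutant P A → IsSelfAdjoint A → ∃ f, A w = κ f w := by
    intro A hA hsa
    have hle := hsa.le_algebraMap_norm_self
    have hge := hsa.neg_algebraMap_norm_le_self
    have e : algebraMap ℝ (K →L[ℂ] K) ‖A‖ = (‖A‖ : ℂ) • 1 := by
      rw [Algebra.algebraMap_eq_smul_one]
      ext k; simp
    rw [e] at hle hge
    -- The shift by `‖A‖` makes `A` positive, with upper bound `2 ‖A‖`.
    obtain ⟨f, hf⟩ := hP.exists_integral_apply_of_nonneg hκ hσ hmul (B := A + (‖A‖ : ℂ) • 1)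
      (c := 2 * ‖A‖) (fun E hE => by rw [mul_add, add_mul, hA E hE]; simp)
      (by rwa [← sub_neg_eq_add, sub_nonneg]) (by positivity) (by
        have h := add_le_add_left hle ((‖A‖ : ℂ) • (1 : K →L[ℂ] K))
        rwa [← add_smul, ← two_mul, ← Complex.ofReal_ofNat, ← Complex.ofReal_mul] at h) w
    refine ⟨f - indicatorConstLp ∞ .univ (measure_ne_top ν _) (‖A‖ : ℂ), ?_⟩
    rw [map_sub, hκ, hP.univ, sub_apply, ← hf]
    simp
  have hBs : IsInBicommutant P (star B) := fun E hE => by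
    have h := hB (star E) fun Δ hΔ => by
      have := congrArg star (hE Δ hΔ)
      rw [star_mul, star_mul, (IsSelfAdjoint.of_nonneg (hP.nonneg Δ hΔ)).star_eq] at this
      exact this.symm
    have := congrArg star h
    rw [star_mul, star_mul, star_star] at this
    exact this.symm
  obtain ⟨f, hf⟩ := h1 (B + star B) (fun E hE => by rw [mul_add, add_mul, hB E hE, hBs E hE])
    (IsSelfAdjoint.add_star_self B)
  obtain ⟨g, hg⟩ := h1 (Complex.I • (star B - B)) (fun E hE => by
    rw [mul_smul_comm, smul_mul_assoc, mul_sub, sub_mul, hB E hE, hBs E hE]) (by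
    rw [IsSelfAdjoint, star_smul, star_sub, star_star, Complex.star_def, Complex.conj_I, neg_smul,
      ← smul_neg, neg_sub])
  -- `B = ½ ((B + B*) + i · i (B* - B))`.
  refine ⟨(1 / 2 : ℂ) • (f + Complex.I • g), ?_⟩
  rw [map_smul, map_add, map_smul, smul_apply, add_apply, smul_apply, ← hf, ← hg, add_apply,
    smul_apply, smul_smul, Complex.I_mul_I, sub_apply]
  module

/-- Choose `f₀` with `B k = κ f₀ k`; then `C = B - κ f₀` kills `k`. For any `l`, comparing the
integrals that represent `C` at `l` and at `k + l` produces `f` and `b` with `f b = 0`, which forces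
`‖C l‖² = 0`. -/
theorem exists_eq_integral (hP : IsPOVM ν P) (hσ : IsStronglySigmaAdditive P)
    (hmul : ∀ Δ, MeasurableSet Δ → P Δ * P Δ = P Δ) {k : K}
    (hk : ∀ Δ, MeasurableSet Δ → P Δ k = 0 → ν Δ = 0) {B : K →L[ℂ] K} (hB : IsInBicommutant P B) :
    ∃ f, B = κ f := by
  have hm := map_smul_eq_mul hκ fun Δ Δ' hΔ hΔ' => hP.inter_eq_mul hmul hΔ hΔ'
  obtain ⟨f₀, hf₀⟩ := hP.exists_integral_apply hκ hσ hmul hB k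
  refine ⟨f₀, ?_⟩
  set C := B - κ f₀ with hC
  have hCb : IsInBicommutant P C := fun E hE => by
    rw [mul_sub, sub_mul, hB E hE, isInBicommutant_integral hκ _ E hE]
  have hCk : C k = 0 := by rw [hC, sub_apply, hf₀, sub_self]
  have hCκ : ∀ f, κ f * C = C * κ f := fun f =>
    hCb _ fun Δ hΔ => (commute_integral hκ (fun Δ' hΔ' => by
      rw [← hP.inter_eq_mul hmul hΔ hΔ', ← hP.inter_eq_mul hmul hΔ' hΔ, Set.inter_comm]) f).symm
  suffices h : C = 0 from sub_eq_zero.mp h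
  ext l
  obtain ⟨f, hf⟩ := hP.exists_integral_apply hκ hσ hmul hCb l
  obtain ⟨b, hb⟩ := hP.exists_integral_apply hκ hσ hmul hCb (k + l)
  have hb' : C l = κ b (k + l) := by rw [← hb, map_add, hCk, zero_add]
  have h1 : κ (f - b) l = κ b k := by
    rw [map_sub, sub_apply, ← hf, hb', map_add, add_sub_cancel_right]
  -- Commuting factors turn this vector into `κ(f - b) C l = C κ(f - b) l = C κ(b) k = κ(b) C k =
  -- 0`.
  have h2 : κ f (κ (f - b) l) = 0 := by
    rw [← mul_apply_eq_comp, ← hm, Lp.smul_comm_top, hm, mul_apply_eq_comp, ← hf,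
      ← mul_apply_eq_comp, hCκ, mul_apply_eq_comp, h1, ← mul_apply_eq_comp, ← hCκ,
      mul_apply_eq_comp, hCk, map_zero]
  rw [h1, ← mul_apply_eq_comp, ← hm] at h2
  have h3 := eq_zero_of_apply_eq_zero hκ hm hk h2
  have h4 : (star f • b : Lp ℂ ∞ ν) = 0 := by
    refine Lp.ext ?_
    filter_upwards [Lp.coeFn_lpSMul (r := ∞) f b, Lp.coeFn_lpSMul (r := ∞) (star f) b,
      Lp.coeFn_star f, Lp.coeFn_zero ℂ ∞ ν] with s h5 h6 h7 h8
    rw [h3, h8, Pi.zero_apply, Pi.smul_apply', smul_eq_mul, eq_comm, mul_eq_zero] at h5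
    rw [h6, h8, Pi.zero_apply, Pi.smul_apply', smul_eq_mul, h7, Pi.star_apply, mul_eq_zero,
      star_eq_zero]
    exact h5
  -- Here `C l` is written as `κ f l` on the left and as `κ b (k + l)` on the right, so the product
  -- is `⟪l, κ(f̄ b)(k + l)⟫`.
  have h5 : inner ℂ (C l) (C l) = 0 := by
    nth_rw 1 [hf]
    rw [← ContinuousLinearMap.adjoint_inner_right, ← ContinuousLinearMap.star_eq_adjoint,
      ← hP.map_star hκ, hb', ← mul_apply_eq_comp, ← hm, h4, map_zero, zero_apply, inner_zero_right]
  rw [inner_self_eq_zero.mp h5, zero_apply]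

/-- The range of the integral of a projection valued measure with a separating vector is an
abelian von Neumann algebra. -/
theorem exists_vonNeumannAlgebra (hP : IsPOVM ν P) (hσ : IsStronglySigmaAdditive P)
    (hmul : ∀ Δ, MeasurableSet Δ → P Δ * P Δ = P Δ) {k : K}
    (hk : ∀ Δ, MeasurableSet Δ → P Δ k = 0 → ν Δ = 0) :
    ∃ B : VonNeumannAlgebra K, (B : Set (K →L[ℂ] K)) = Set.range κ ∧
      ∀ a ∈ B, ∀ b ∈ B, a * b = b * a := by
  have hm := map_smul_eq_mul hκ fun Δ Δ' hΔ hΔ' => hP.inter_eq_mul hmul hΔ hΔ'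
  let A : StarSubalgebra ℂ (K →L[ℂ] K) :=
    { carrier := Set.range κ
      mul_mem' := by rintro _ _ ⟨f, rfl⟩ ⟨g, rfl⟩; exact ⟨f • g, hm f g⟩
      add_mem' := by rintro _ _ ⟨f, rfl⟩ ⟨g, rfl⟩; exact ⟨f + g, map_add κ f g⟩
      algebraMap_mem' := fun c => ⟨indicatorConstLp ∞ .univ (measure_ne_top ν _) c, by
        rw [hκ, hP.univ, Algebra.algebraMap_eq_smul_one]⟩
      star_mem' := by rintro _ ⟨f, rfl⟩; exact ⟨star f, hP.map_star hκ f⟩ }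
  have hA : (A : Set (K →L[ℂ] K)).centralizer.centralizer = A := by
    refine Set.Subset.antisymm (fun B hB => ?_) Set.subset_centralizer_centralizer
    obtain ⟨f, hf⟩ := hP.exists_eq_integral hκ hσ hmul hk (B := B) fun E hE => hB E (by
      rintro _ ⟨f, rfl⟩
      exact (commute_integral hκ hE f).symm)
    exact ⟨f, hf.symm⟩
  refine ⟨⟨A, hA⟩, rfl, ?_⟩
  rintro _ ⟨f, rfl⟩ _ ⟨g, rfl⟩
  rw [← hm, ← hm, Lp.smul_comm_top]

end Integral
end IsPOVM

end

/-! ### Strong `σ`-additivity and conclusion -/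

section

theorem IsPOVM.sum_range_eq {S : Type*} [MeasurableSpace S] {ν : Measure S}
    {K : Type*} [NormedAddCommGroup K] [InnerProductSpace ℂ K] [CompleteSpace K]
    {P : Set S → K →L[ℂ] K} (hP : IsPOVM ν P) {Δ : ℕ → Set S} (hΔ : ∀ i, MeasurableSet (Δ i))
    (hd : Pairwise (Disjoint on Δ)) (n : ℕ) :
    ∑ i ∈ Finset.range n, P (Δ i) = P (⋃ i, Δ i) - P (⋃ i, Δ (i + n)) := by
  induction n with
  | zero => simp
  | succ n ih =>
    have h : P (⋃ i, Δ (i + n)) = P (Δ n) + P (⋃ i, Δ (i + (n + 1))) := by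
      rw [← hP.union _ _ (hΔ n) (.iUnion fun i => hΔ _)
        (Set.disjoint_iUnion_right.mpr fun i => hd (by omega)),
        ← Set.union_iUnion_nat_succ fun i => Δ (i + n)]
      simp only [zero_add, add_assoc, add_comm 1 n]
    rw [Finset.sum_range_succ, ih, h]
    abel

theorem isClosed_tendsto_zero_of_norm_le {K : Type*} [NormedAddCommGroup K] [NormedSpace ℂ K]
    (A : ℕ → K →L[ℂ] K) (hA : ∀ n k, ‖A n k‖ ≤ ‖k‖) :
    IsClosed {k | Filter.Tendsto (fun n => A n k) Filter.atTop (nhds 0)} := by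
  refine isClosed_of_closure_subset fun k hk => Metric.tendsto_atTop.mpr fun ε hε => ?_
  obtain ⟨l, hl, hkl⟩ := Metric.mem_closure_iff.mp hk (ε / 2) (half_pos hε)
  obtain ⟨N, hN⟩ := Metric.tendsto_atTop.mp hl (ε / 2) (half_pos hε)
  refine ⟨N, fun n hn => ?_⟩
  have h1 := hA n (k - l)
  have h2 := hN n hn
  rw [dist_zero_right] at h2 ⊢
  rw [dist_eq_norm] at hkl
  have h3 : A n k = A n (k - l) + A n l := by rw [map_sub, sub_add_cancel]
  rw [h3]
  linarith [norm_add_le (A n (k - l)) (A n l)]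

variable {X : Type*} [CStarAlgebra X] [PartialOrder X] [StarOrderedRing X]
  {H : Type*} [NormedAddCommGroup H] [InnerProductSpace ℂ H] [CompleteSpace H]
  {K : Type*} [NormedAddCommGroup K] [InnerProductSpace ℂ K] [CompleteSpace K]
  {M : VonNeumannAlgebra H} {S : Type*} [MeasurableSpace S]

namespace MinimalStinespring.IsDerivative

variable {T : CPMap X M} {D : MinimalStinespring K T} {μ : CPMeasure X M S}
  {P : Set S → K →L[ℂ] K} {ν : Measure S}

/-- It suffices that `P` of the tails tends strongly to `0`. As these are projections, `‖P(E) π(x) V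
ξ‖² = ⟪ξ, μ(E)(x* x) ξ⟫`, which is `σ`-additive in `E`; contractivity passes from these vectors to
all of `K`. -/
theorem isStronglySigmaAdditive (hD : D.IsDerivative μ P) (hP : IsPOVM ν P)
    (hmul : ∀ Δ, MeasurableSet Δ → P Δ * P Δ = P Δ) : IsStronglySigmaAdditive P := by
  intro Δ hΔ hd k
  have hm : ∀ n, MeasurableSet (⋃ i, Δ (i + n)) := fun n => .iUnion fun i => hΔ _
  suffices h : Filter.Tendsto (fun n => P (⋃ i, Δ (i + n)) k) Filter.atTop (nhds 0) by
    have h1 := (tendsto_const_nhds (x := P (⋃ i, Δ i) k)).sub h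
    rw [sub_zero] at h1
    refine h1.congr fun n => ?_
    rw [← sub_apply, ← hP.sum_range_eq hΔ hd, sum_apply]
  refine D.induction_on_dense (p := fun k =>
      Filter.Tendsto (fun n => P (⋃ i, Δ (i + n)) k) Filter.atTop (nhds 0))
    (isClosed_tendsto_zero_of_norm_le _ fun n => hP.norm_apply_le hmul (hm n)) (by simp)
    (fun k l hk hl => by simpa using hk.add hl) (fun x ξ => ?_) k
  have hF : ∀ E, MeasurableSet E → inner ℂ (D.π x (D.V ξ)) (P E (D.π x (D.V ξ))) =
      M.vectorFunctional ξ ξ (μ E (star x * x)) := fun E hE => by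
    rw [D.inner_of_commute (hD.commute E hE), hD.compress_eq E hE, M.vectorFunctional_apply]
  have hs := (μ.hasSum_iUnion Δ hΔ hd _ (M.isNormal_vectorFunctional ξ ξ)
    (star x * x)).tendsto_sum_nat
  have h0 : Filter.Tendsto (fun n => ((‖P (⋃ i, Δ (i + n)) (D.π x (D.V ξ))‖ ^ 2 : ℝ) : ℂ))
      Filter.atTop (nhds 0) := by
    have h1 := (tendsto_const_nhds
      (x := M.vectorFunctional ξ ξ (μ (⋃ i, Δ i) (star x * x)))).sub hs
    rw [sub_self] at h1
    refine h1.congr fun n => ?_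
    rw [ofReal_norm_sq_eq_inner, ← hP.inner_apply_self hmul (hm n), ← hF _ (.iUnion hΔ)]
    have h2 := hP.sum_range_eq hΔ hd n
    rw [eq_sub_iff_add_eq, ← eq_sub_iff_add_eq'] at h2
    rw [h2, sub_apply, sum_apply, inner_sub_right, inner_sum]
    simp_rw [← fun i => hF _ (hΔ i)]
  have h1 : Filter.Tendsto (fun n => ‖P (⋃ i, Δ (i + n)) (D.π x (D.V ξ))‖ ^ 2)
      Filter.atTop (nhds 0) := by
    have := Complex.continuous_re.continuousAt.tendsto.comp h0
    simpa [Function.comp_def, ← Complex.ofReal_pow] using this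
  rw [tendsto_zero_iff_norm_tendsto_zero]
  have h2 := h1.sqrt
  simpa [Real.sqrt_sq] using h2

/-- `ρ(μ(Δ) 1) = ∑ ⟪V ξₙ, P(Δ) V ηₙ⟫`, so the vectors `V ηₙ` jointly separate `P`. -/
theorem eq_zero_of_apply_V_eq_zero (hD : D.IsDerivative μ P)
    {ρ : M.toStarSubalgebra →ₗ[ℂ] ℂ} (hν : μ.IsEquivalentTo ρ ν)
    {ξ η : lp (fun _ : ℕ => H) 2}
    (hρ : ∀ a : M.toStarSubalgebra, ρ a = traceClassFunctional ξ η (a : H →L[ℂ] H)) {Δ : Set S}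
    (hΔ : MeasurableSet Δ) (h : ∀ n, P Δ (D.V (η n)) = 0) : ν Δ = 0 := by
  rw [hν Δ hΔ, hρ, ← hD.compress_eq Δ hΔ, traceClassFunctional]
  simp_rw [D.inner_compress, map_one, one_apply_eq_self, h, inner_zero_right]
  exact tsum_zero

end MinimalStinespring.IsDerivative

end

theorem mainTheorem5
    {X : Type*} [CStarAlgebra X] [PartialOrder X] [StarOrderedRing X]
    {H : Type*} [NormedAddCommGroup H] [InnerProductSpace ℂ H] [CompleteSpace H]
    {K : Type*} [NormedAddCommGroup K] [InnerProductSpace ℂ K] [CompleteSpace K]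
    (M : VonNeumannAlgebra H) (hM : M.IsSigmaFinite)
    {S : Type*} [MeasurableSpace S]
    (T : CPMap X M) (D : MinimalStinespring K T)
    (μ : CPMeasure X M S) (hμ : μ Set.univ = T)
    (ν : Measure S) [IsFiniteMeasure ν]
    (hν : ∃ ρ : M.toStarSubalgebra →ₗ[ℂ] ℂ, M.IsNormalFaithfulState ρ ∧ μ.IsEquivalentTo ρ ν) :
    ∃ κ : Lp ℂ ∞ ν →ₗ[ℂ] (K →L[ℂ] K),
      μ.IsKappa D ν κ ∧ (∀ κ', μ.IsKappa D ν κ' → κ' = κ) ∧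
      List.TFAE [
        μ.IsOrthogonalOf T,
        IsStarRepresentation κ ∧ Function.Injective κ,
        IsStarRepresentation κ] ∧
      (μ.IsOrthogonalOf T →
        ∃ B : VonNeumannAlgebra K, (B : Set (K →L[ℂ] K)) = Set.range κ ∧
          (∀ a ∈ B, ∀ b ∈ B, a * b = b * a) ∧ (B : Set (K →L[ℂ] K)) ⊆ D.relCommutant) := by
  obtain ⟨ρ, hρ, hρν⟩ := hν
  obtain ⟨P, hD⟩ := D.exists_isDerivative hμ
  have hP := hD.isPOVM hμ hρ hρν
  obtain ⟨κ, hκ⟩ := hP.exists_integral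
  have hiff := hD.isOrthogonalOf_iff hP hμ
  have hkappa := hD.isKappa hP hκ
  refine ⟨κ.toLinearMap, hkappa, fun κ' hκ' => D.kappa_unique hkappa hκ', ?_, fun h => ?_⟩
  · tfae_have 1 → 2 := fun h => by
      have hmul := hiff.mp h
      have hm := IsPOVM.map_smul_eq_mul hκ fun Δ Δ' hΔ hΔ' => hP.inter_eq_mul hmul hΔ hΔ'
      exact ⟨⟨hm, hP.map_star hκ⟩, IsPOVM.injective_of_map_smul hκ hm fun Δ hΔ h0 =>
        (hρν Δ hΔ).mpr ((hD.eq_zero_iff hρ hΔ).mp h0)⟩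
    tfae_have 2 → 3 := fun h => h.1
    tfae_have 3 → 1 := fun h =>
      hiff.mpr fun Δ hΔ => IsPOVM.isIdempotentElem_of_map_smul hκ h.map_mul hΔ
    tfae_finish
  · have hmul := hiff.mp h
    have hσ := hD.isStronglySigmaAdditive hP hmul
    obtain ⟨ξ, η, hξη⟩ := hρ.normal
    obtain ⟨k, hk⟩ := hP.exists_separating hσ hmul (fun n => D.V (η n)) fun Δ hΔ h0 =>
      hD.eq_zero_of_apply_V_eq_zero hρν hξη hΔ h0
    obtain ⟨B, hB, hcomm⟩ := hP.exists_vonNeumannAlgebra hκ hσ hmul hk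
    refine ⟨B, hB, hcomm, ?_⟩
    rw [hB]
    rintro _ ⟨f, rfl⟩
    exact hkappa.mem_relCommutant f
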